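/- Let $d\in\{2,3\}$, $m\in(d-4,d]$, and let $D\subset\mathbb R^d$ be a bounded domain. Write $\hat g(\xi)=\int_{\mathbb R^d}e^{-\mathrm i x\cdot\xi}g(x)\,dx$. Let $f$ be a $\mathbb C$-valued centered generalized microlocally isotropic Gaussian random field of order $-m$ in $D$. That is, $f$ is a random distribution on $\mathbb R^d$; for every test function $\psi\in C_0^\infty(\mathbb R^d;\mathbb C)$, $\langle f,\psi\rangle$ is a complex Gaussian variable (jointly Gaussian real and imaginary parts) with mean $0$; and for all test functions $\varphi,\psi$ one has $\mathbb E[\langle \bar f,\varphi\rangle\langle f,\psi\rangle]=\int (\mathcal C_f\varphi)\psi\,dx$ and $\mathbb E[\langle f,\varphi\rangle\langle f,\psi\rangle]=\int (\mathcal R_f\varphi)\psi\,dx$, where $\mathcal C_f\varphi(x)=(2\pi)^{-d}\int e^{\mathrm i x\cdot\xi}\sigma^c(x,\xi)\hat\varphi(\xi)\,d\xi$ and $\mathcal R_f\varphi(x)=(2\pi)^{-d}\int e^{\mathrm i x\cdot\xi}\sigma^r(x,\xi)\hat\varphi(\xi)\,d\xi$. Here, for $\eta\in\{c,r\}$, $\sigma^\eta\in\mathcal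 S^{-m}$, $\sigma^\eta(x,\xi)=a^\eta(x)|\xi|^{-m}+b^\eta(x,\xi)$ for all $|\xi|\ge1$, $b^\eta\in\mathcal S^{-m-1}$, and $a^\eta,\ b^\eta(\cdot,\xi),\ \sigma^\eta(\cdot,\xi)\in C_0^\infty(D)$ for all $\xi$, where $\mathcal S^{s}$ is the set of $\sigma\in C^\infty(\mathbb R^d\times\mathbb R^d)$ with $|\partial_\xi^{\gamma_1}\partial_x^{\gamma_2}\sigma(x,\xi)|\le C_{\gamma_1,\gamma_2}(1+|\xi|)^{s-|\gamma_1|}$ for all multi-indices $\gamma_1,\gamma_2$. Let $$u^\infty(\hat x,\kappa)=-C_d\,\kappa^{\frac{d-3}2}\int_{\mathbb R^d}e^{-\mathrm i\kappa\hat x\cdot y}f(y)\,dy,\qquad C_2=\frac{e^{\mathrm i\pi/4}}{\sqrt{8\pi}},\quad C_3=\frac1{4\pi},$$ be the far-field pattern of the outgoing solution of the Helmholtz equation $\Delta u+\kappa^2u=f$ in $\mathbb R^d$; the integral denotes the pairing $\langle f,\chi e^{-\mathrm i\kappa\hat x\cdot y}\rangle$ with any cutoff $\chi\in C_0^\infty(\mathbb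 R^d)$ equal to $1$ in a neighbourhood of $\overline D$. Then for all $\hat x\in\mathbb S^{d-1}$ and $\tau\ge0$, almost surely $$\lim_{Q\to\infty}\frac1Q\int_Q^{2Q}\kappa^{m+3-d}u^\infty(\hat x,\kappa+\tau)\overline{u^\infty(\hat x,\kappa)}\,d\kappa=|C_d|^2\,\widehat{a^c}(\tau\hat x),\qquad(1)$$ $$\lim_{Q\to\infty}\frac1Q\int_Q^{2Q}\kappa^{m+3-d}u^\infty(\hat x,\kappa+\tau)u^\infty(-\hat x,\kappa)\,d\kappa=C_d^2\,\widehat{a^r}(\tau\hat x).\qquad(2)$$ Moreover, for every nonempty open $\Theta\subset[0,\infty)\times\mathbb S^{d-1}$, $a^c$ and $a^r$ are uniquely determined by (1) and (2), respectively, for a single realization and $(\tau,\hat x)\in\Theta$: almost surely, no function in $C_0^\infty(\mathbb R^d)$ other than $a^c$ (respectively $a^r$) satisfies (1) (respectively (2)) in its place at all $(\tau,\hat x)\in\Theta$; and for every countable dense subset $S$ of $\Theta$, almost surely $a^c$ (respectively $a^r$) is the one and only function in $C_0^\infty(\mathbb R^d)$ that satisfies (1) (respectively (2)) in its place at all $(\tau,\hat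 x)\in S$. -/

import Mathlib

open MeasureTheory ProbabilityTheory Filter Topology Set
open scoped NNReal ComplexConjugate

namespace AcousticSource

noncomputable section

/-- Euclidean space `ℝᵈ`. -/
abbrev Space (d : ℕ) : Type := EuclideanSpace ℝ (Fin d)

/-- The space `𝓓(ℝᵈ; ℂ)` of complex-valued smooth compactly supported test functions, with
its usual locally convex topology. -/
abbrev TestFun (d : ℕ) : Type := TestFunction (⊤ : TopologicalSpace.Opens (Space d)) ℂ ⊤

/-- The space `𝓓'(ℝᵈ; ℂ)` of complex distributions: the continuous `ℂ`-linear functionals on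
complex test functions (bilinear pairing, no conjugation). -/
abbrev Distrib (d : ℕ) : Type := TestFun d →L[ℂ] ℂ

/-- The complex conjugate of a test function. -/
def conjTest {d : ℕ} (φ : TestFun d) : TestFun d :=
  TestFunction.postcompCLM (Complex.conjCLE : ℂ →L[ℝ] ℂ) φ

/-- The Fourier transform with the convention `φ̂(ξ) = ∫ e^{-i x·ξ} φ(x) dx`. -/
def fourierT {d : ℕ} (φ : Space d → ℂ) (ξ : Space d) : ℂ :=
  ∫ x, Complex.exp (-(Complex.I * ((inner ℝ x ξ : ℝ) : ℂ))) * φ x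

/-- `g ∈ C₀^∞(D)`: a smooth function on `ℝᵈ` whose support is compact and contained in `D`. -/
def IsSmoothCompactIn {d : ℕ} (D : Set (Space d)) (g : Space d → ℂ) : Prop :=
  ContDiff ℝ ((⊤ : ℕ∞) : WithTop ℕ∞) g ∧ HasCompactSupport g ∧ tsupport g ⊆ D

/-- The symbol class `𝒮^r(ℝᵈ × ℝᵈ)` of order `r`: smooth functions `σ(x, ξ)` all of whose
derivatives satisfy `|∂_ξ^k ∂_x^l σ(x, ξ)| ≤ C_{k,l} (1 + |ξ|)^{r - k}`. -/
def IsSymbol {d : ℕ} (r : ℝ) (σ : Space d → Space d → ℂ) : Prop :=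
  ContDiff ℝ ((⊤ : ℕ∞) : WithTop ℕ∞) (fun p : Space d × Space d => σ p.1 p.2) ∧
  ∀ k l : ℕ, ∃ C : ℝ, 0 < C ∧ ∀ x ξ : Space d,
    ‖iteratedFDeriv ℝ k (fun η => iteratedFDeriv ℝ l (fun y => σ y η) x) ξ‖
      ≤ C * (1 + ‖ξ‖) ^ (r - (k : ℝ))

/-- The pseudo-differential operator with symbol `σ`:
`(Op(σ) φ)(x) = (2π)^{-d} ∫ e^{i x·ξ} σ(x, ξ) φ̂(ξ) dξ`. -/
def pseudoDiff {d : ℕ} (σ : Space d → Space d → ℂ) (φ : TestFun d) (x : Space d) : ℂ :=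
  (((2 * Real.pi) ^ d : ℝ) : ℂ)⁻¹ *
    ∫ ξ, Complex.exp (Complex.I * ((inner ℝ x ξ : ℝ) : ℂ)) * σ x ξ * fourierT φ ξ

/-- A symbol of order `-m` with principal symbol `a(x) |ξ|^{-m}`, `a ∈ C₀^∞(D)`, localized in `D`:
`σ(x, ξ) = a(x) |ξ|^{-m} + b(x, ξ)` with `b` a symbol of order `-m - 1` and
`a, b(·, ξ), σ(·, ξ) ∈ C₀^∞(D)`. As usual for a homogeneous principal symbol, which
is singular at `ξ = 0`, the decomposition is required away from `ξ = 0`. -/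
def HasPrincipalSymbol {d : ℕ} (D : Set (Space d)) (m : ℝ) (a : Space d → ℂ)
    (σ : Space d → Space d → ℂ) : Prop :=
  IsSymbol (-m) σ ∧ (∀ ξ, IsSmoothCompactIn D (fun x => σ x ξ)) ∧
  IsSmoothCompactIn D a ∧
  ∃ b : Space d → Space d → ℂ, IsSymbol (-m - 1) b ∧
    (∀ ξ, IsSmoothCompactIn D (fun x => b x ξ)) ∧
    ∀ x ξ : Space d, 1 ≤ ‖ξ‖ → σ x ξ = a x * ((‖ξ‖ ^ (-m) : ℝ) : ℂ) + b x ξ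

section Random

variable {d : ℕ} {Ω : Type*} [MeasurableSpace Ω]

/-- The expectation `⟨𝔼f, ψ⟩ = 𝔼⟨f, ψ⟩`. -/
def mean (P : Measure Ω) (f : Ω → Distrib d) (ψ : TestFun d) : ℂ := ∫ ω, f ω ψ ∂P

/-- The covariance form `⟨𝒞_f φ, ψ⟩ = 𝔼[⟨conj (f - 𝔼f), φ⟩ ⟨f - 𝔼f, ψ⟩]`, where
`⟨conj g, φ⟩ = conj ⟨g, conj φ⟩`. -/
def covForm (P : Measure Ω) (f : Ω → Distrib d) (φ ψ : TestFun d) : ℂ :=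
  ∫ ω, conj (f ω (conjTest φ) - mean P f (conjTest φ)) * (f ω ψ - mean P f ψ) ∂P

/-- The relation (pseudo-covariance) form `⟨ℛ_f φ, ψ⟩ = 𝔼[⟨f - 𝔼f, φ⟩ ⟨f - 𝔼f, ψ⟩]`. -/
def relForm (P : Measure Ω) (f : Ω → Distrib d) (φ ψ : TestFun d) : ℂ :=
  ∫ ω, (f ω φ - mean P f φ) * (f ω ψ - mean P f ψ) ∂P

/-- The form `⟨A φ, ψ⟩` is that of a pseudo-differential operator `A` of order `-m` whose symbol
is localized in `D` and has principal symbol `a(x) |ξ|^{-m}`. -/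
def IsPseudoDiffForm (D : Set (Space d)) (m : ℝ) (a : Space d → ℂ)
    (A : TestFun d → TestFun d → ℂ) : Prop :=
  ∃ σ : Space d → Space d → ℂ, HasPrincipalSymbol D m a σ ∧
    ∀ φ ψ : TestFun d, A φ ψ = ∫ x, pseudoDiff σ φ x * ψ x

/-- `f` is a `ℂ`-valued centered generalized microlocally isotropic Gaussian (GMIG) random field of
order `-m` in `D`, with principal symbols `ac(x) |ξ|^{-m}` and `ar(x) |ξ|^{-m}` of its
covariance and relation operators. (`HasGaussianLaw` for a `ℂ`-valued variable says that
its real and imaginary parts are jointly Gaussian.) -/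
structure IsCenteredGMIG (P : Measure Ω) (f : Ω → Distrib d) (D : Set (Space d)) (m : ℝ)
    (ac ar : Space d → ℂ) : Prop where
  gaussian : ∀ ψ : TestFun d, HasGaussianLaw (fun ω => f ω ψ) P
  centered : ∀ ψ : TestFun d, mean P f ψ = 0
  cov : IsPseudoDiffForm D m ac (covForm P f)
  rel : IsPseudoDiffForm D m ar (relForm P f)

end Random

/-- The constant in the far-field asymptotics of the outgoing fundamental solution of the
Helmholtz equation: `C₂ = e^{iπ/4} / √(8π)` and `C₃ = 1 / (4π)`. -/
def farConst (d : ℕ) : ℂ :=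
  if d = 2 then Complex.exp (Complex.I * (Real.pi / 4 : ℝ)) / (Real.sqrt (8 * Real.pi) : ℂ)
  else 1 / (4 * (Real.pi : ℂ))

/-- The test function `y ↦ χ(y) e^{-i κ x·y}`. -/
def cutPlaneWave {d : ℕ} (χ : TestFun d) (x : Space d) (κ : ℝ) : TestFun d where
  toFun y := χ y * Complex.exp (-(Complex.I * ((κ * inner ℝ x y : ℝ) : ℂ)))
  contDiff' := by
    have h : ContDiff ℝ ((⊤ : ℕ∞) : WithTop ℕ∞) (fun y : Space d =>
        Complex.exp (-(Complex.I * ((κ * inner ℝ x y : ℝ) : ℂ)))) := by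
      refine ContDiff.cexp (ContDiff.neg (contDiff_const.mul ?_))
      exact Complex.ofRealCLM.contDiff.comp (contDiff_const.mul (contDiff_const.inner ℝ contDiff_id))
    exact χ.contDiff.mul h
  hasCompactSupport' := χ.hasCompactSupport.mul_right
  tsupport_subset' := fun _ _ => trivial

/-- The far-field pattern of the outgoing solution of `Δu + κ²u = T` in `ℝᵈ`, in direction `x`, for
a distribution `T` supported in a compact set on a neighbourhood of which `χ = 1`:
`u^∞(x, κ) = -C_d κ^{(d-3)/2} ∫ e^{-i κ x·y} T(y) dy`. The integral is the pairing of the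
compactly supported distribution `T` with a smooth function, that is, the pairing with its
product by such a cutoff `χ`. -/
def farField {d : ℕ} (χ : TestFun d) (T : Distrib d) (x : Space d) (κ : ℝ) : ℂ :=
  -farConst d * ((κ ^ (((d : ℝ) - 3) / 2) : ℝ) : ℂ) * T (cutPlaneWave χ x κ)

/-- `(1/Q) ∫_Q^{2Q} κ^{m+3-d} u(x, κ+τ) conj (u(x, κ)) dκ`. -/
def avgCov {d : ℕ} (m : ℝ) (u : Space d → ℝ → ℂ) (τ : ℝ) (x : Space d) (Q : ℝ) : ℂ :=
  ((1 / Q : ℝ) : ℂ) *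
    ∫ κ in Q..(2 * Q), ((κ ^ (m + 3 - (d : ℝ)) : ℝ) : ℂ) * u x (κ + τ) * conj (u x κ)

/-- `(1/Q) ∫_Q^{2Q} κ^{m+3-d} u(x, κ+τ) u(-x, κ) dκ`. -/
def avgRel {d : ℕ} (m : ℝ) (u : Space d → ℝ → ℂ) (τ : ℝ) (x : Space d) (Q : ℝ) : ℂ :=
  ((1 / Q : ℝ) : ℂ) *
    ∫ κ in Q..(2 * Q), ((κ ^ (m + 3 - (d : ℝ)) : ℝ) : ℂ) * u x (κ + τ) * u (-x) κ

/-- The function `a'` reproduces the data `A` at the points of `S`: for `(τ, x) ∈ S` the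
band averages `A τ x Q` tend to `c · â'(τ x)` as `Q → ∞`. -/
def Fits {d : ℕ} (c : ℂ) (S : Set (ℝ≥0 × Metric.sphere (0 : Space d) 1))
    (A : ℝ → Space d → ℝ → ℂ) (a' : Space d → ℂ) : Prop :=
  ∀ p ∈ S, Tendsto (A (p.1 : ℝ) (p.2 : Space d)) atTop
    (𝓝 (c * fourierT a' ((p.1 : ℝ) • (p.2 : Space d))))

/-- Almost surely, `a` is uniquely determined by a single realization of the data `A ω` on `Θ`.
First: almost surely, no function of class `C₀^∞` other than `a` fits the data on `Θ`.
Second: for every countable dense `S ⊆ Θ`, almost surely `a` is the one and only function of class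
`C₀^∞` that fits the data on `S`. (For each fixed point the data have their limit outside a
null set that depends on the point, hence the countable set in the second part.) -/
def DeterminedOn {d : ℕ} {Ω : Type*} [MeasurableSpace Ω] (P : Measure Ω) (c : ℂ)
    (Θ : Set (ℝ≥0 × Metric.sphere (0 : Space d) 1))
    (A : Ω → ℝ → Space d → ℝ → ℂ) (a : Space d → ℂ) : Prop :=
  (∀ᵐ ω ∂P, ∀ a' : Space d → ℂ, IsSmoothCompactIn univ a' → Fits c Θ (A ω) a' → a' = a) ∧
  ∀ S : Set (ℝ≥0 × Metric.sphere (0 : Space d) 1), S.Countable → S ⊆ Θ → Θ ⊆ closure S →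
    ∀ᵐ ω ∂P, ∀ a' : Space d → ℂ, IsSmoothCompactIn univ a' → (Fits c S (A ω) a' ↔ a' = a)

end

end AcousticSource

open AcousticSource

/-! Up to the factor `-C_d κ^{(d-3)/2}`, the far field is the pairing of `f` with the cut-off plane
wave `χ e^{-iκx·y}`. Applied to a wave packet of frequency `k`, a pseudo-differential operator
multiplies by its symbol frozen at `k`, up to one order less (`norm_pseudoDiff_sub_le`). Since the
cutoff equals 1 on `D` and the symbols vanish off `D`, the covariance of two plane wave coefficients
is `κ^{-m} âc(κ'x' - κx) + O(κ^{-m-1})`, and their relation is `κ^{-m} âr(κx + κ'x') + O(κ^{-m-1})`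
(`norm_integral_cutPlaneWave_sub_le`). With `κ' = κ + τ`, equal directions in the first formula and
opposite ones in the second put the argument at `±τx`, arranged so as to be `τx`; hence the weighted
products have expectations that converge to the right-hand sides at rate `1/κ`.

The frequency average replaces the expectation by ergodicity. Isserlis' formula writes the
covariance of two Gaussian products as products of second moments. These decay like `(1 + |s - t|)⁻¹
+ s⁻¹`, because `âc` and `âr` decay and `‖sx ± tx'‖ ≥ |s - t|` for unit vectors. So the centered
products have correlations bounded by `(1 + (s - t)²)⁻¹ + s⁻² + t⁻²`, which suffices for a strong
law in continuous time (`ae_tendsto_average_zero`): summable second moments along the times `n²`,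
and control of the gaps between them.

For uniqueness, an open set of polar coordinates contains the coordinates of an open set of
frequencies. The Fourier transform of a compactly supported function is entire along lines, so
agreement there is agreement everywhere, and Fourier inversion concludes
(`eq_of_fourierT_eqOn_polar`). Exceptional null sets are handled by a countable dense set of data
points, from which continuity of the transforms recovers all of `Θ`. -/

namespace AcousticSource
noncomputable section

/-! ### Fourth moments of Gaussian families. -/

section Gaussian

/-- The fourth moment is the fourth derivative at 0 of the moment generating function `exp(v t²/2)`;
each derivative of `exp(v t²/2) p(t)` turns `p` into `v t p + p'`. -/
theorem integral_pow_four_gaussianReal (v : ℝ≥0) :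
    ∫ x, x ^ 4 ∂(gaussianReal 0 v) = 3 * (v : ℝ) ^ 2 := by
  have h := iteratedDeriv_mgf_zero (X := fun x : ℝ => x) (μ := gaussianReal 0 v) (by simp) 4
  have h' : ∫ x, x ^ 4 ∂(gaussianReal 0 v)
      = iteratedDeriv 4 (mgf (fun x : ℝ => x) (gaussianReal 0 v)) 0 := by
    rw [h]; rfl
  rw [h', mgf_fun_id_gaussianReal]
  have hE : ∀ t : ℝ, HasDerivAt (fun t : ℝ => Real.exp (0 * t + v * t ^ 2 / 2))
      (Real.exp (0 * t + v * t ^ 2 / 2) * (v * t)) t := by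
    intro t
    have : HasDerivAt (fun t : ℝ => 0 * t + v * t ^ 2 / 2) (v * t) t := by
      have := ((hasDerivAt_id t).const_mul (0 : ℝ)).add
        ((((hasDerivAt_id t).pow 2).const_mul (v : ℝ)).div_const 2)
      convert! this using 1
      simp; ring
    exact this.exp
  have key : ∀ (p p' : ℝ → ℝ), (∀ t, HasDerivAt p (p' t) t) →
      deriv (fun t : ℝ => Real.exp (0 * t + v * t ^ 2 / 2) * p t)
        = fun t => Real.exp (0 * t + v * t ^ 2 / 2) * (v * t * p t + p' t) := by
    intro p p' hp
    funext t
    exact ((hE t).mul (hp t)).deriv.trans (by ring)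
  have d1 : deriv (fun t : ℝ => Real.exp (0 * t + v * t ^ 2 / 2))
      = fun t => Real.exp (0 * t + v * t ^ 2 / 2) * (v * t) := funext fun t => (hE t).deriv
  have hm : ∀ (c : ℝ) (n : ℕ) (t : ℝ), HasDerivAt (fun t : ℝ => c * t ^ n) (c * (n * t ^ (n - 1))) t :=
    fun c n t => (hasDerivAt_pow n t).const_mul c
  have d2 := key (fun t => v * t) (fun t => v) (fun t => by simpa using hm v 1 t)
  have d3 := key (fun t => v * t * (v * t) + v) (fun t => 2 * v ^ 2 * t) (fun t => by
    have := (hm ((v : ℝ) ^ 2) 2 t).add_const (v : ℝ)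
    convert! this using 1
    · funext s; ring
    · simp; ring)
  have d4 := key (fun t => v * t * (v * t * (v * t) + v) + 2 * v ^ 2 * t)
    (fun t => 3 * v ^ 3 * t ^ 2 + 3 * v ^ 2) (fun t => by
    have := (hm ((v : ℝ) ^ 3) 3 t).add (hm (3 * (v : ℝ) ^ 2) 1 t)
    convert! this using 1
    · funext s; simp; ring
    · simp; ring)
  rw [iteratedDeriv_succ, iteratedDeriv_succ, iteratedDeriv_succ, iteratedDeriv_one, d1, d2, d3, d4]
  simp

variable {Ω : Type*} [MeasurableSpace Ω] {P : Measure Ω}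

theorem integral_pow_four_of_hasGaussianLaw {X : Ω → ℝ} (hX : HasGaussianLaw X P)
    (h0 : ∫ ω, X ω ∂P = 0) : ∫ ω, X ω ^ 4 ∂P = 3 * (∫ ω, X ω ^ 2 ∂P) ^ 2 := by
  have := hX.isProbabilityMeasure
  have h1 := hX.map_eq_gaussianReal
  rw [h0] at h1
  have h2 : ∫ ω, X ω ^ 4 ∂P = ∫ x, x ^ 4 ∂(P.map X) := by
    rw [integral_map hX.aemeasurable (by fun_prop)]
  rw [h2, h1, integral_pow_four_gaussianReal, Real.coe_toNNReal _ (variance_nonneg _ _),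
    variance_of_integral_eq_zero hX.aemeasurable h0]

theorem integrable_mul_of_hasGaussianLaw {X Y : Ω → ℝ} (hX : HasGaussianLaw X P)
    (hY : HasGaussianLaw Y P) : Integrable (fun ω => X ω * Y ω) P :=
  hX.memLp_two.integrable_mul hY.memLp_two

theorem memLp_two_mul_of_hasGaussianLaw {X Y : Ω → ℝ} (hX : HasGaussianLaw X P)
    (hY : HasGaussianLaw Y P) : MemLp (fun ω => X ω * Y ω) 2 P := by
  have hp : ENNReal.HolderTriple 4 4 2 := ⟨by
    rw [← two_mul, show (4 : ENNReal) = 2 * 2 by norm_num, ENNReal.mul_inv (by simp) (by simp),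
      ← mul_assoc, ENNReal.mul_inv_cancel (by simp) (by simp), one_mul]⟩
  exact (hY.memLp (p := 4) (by simp)).mul (hX.memLp (p := 4) (by simp)) (hpqr := hp)

theorem integrable_mul_mul_mul_of_hasGaussianLaw {X Y Z W : Ω → ℝ} (hX : HasGaussianLaw X P)
    (hY : HasGaussianLaw Y P) (hZ : HasGaussianLaw Z P) (hW : HasGaussianLaw W P) :
    Integrable (fun ω => X ω * Y ω * (Z ω * W ω)) P :=
  (memLp_two_mul_of_hasGaussianLaw hX hY).integrable_mul (memLp_two_mul_of_hasGaussianLaw hZ hW)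

/-- Isserlis' formula for four members of a centered Gaussian family. -/
theorem integral_mul_mul_mul_of_hasGaussianLaw {V : Type*} [AddCommGroup V] (R : V → Ω → ℝ)
    (hadd : ∀ v w ω, R (v + w) ω = R v ω + R w ω) (hsub : ∀ v w ω, R (v - w) ω = R v ω - R w ω)
    (hG : ∀ v, HasGaussianLaw (R v) P) (h0 : ∀ v, ∫ ω, R v ω ∂P = 0) (a b c d : V) :
    ∫ ω, R a ω * R b ω * (R c ω * R d ω) ∂P =
      (∫ ω, R a ω * R b ω ∂P) * (∫ ω, R c ω * R d ω ∂P)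
      + (∫ ω, R a ω * R c ω ∂P) * (∫ ω, R b ω * R d ω ∂P)
      + (∫ ω, R a ω * R d ω ∂P) * (∫ ω, R b ω * R c ω ∂P) := by
  set B : V → V → ℝ := fun v w => ∫ ω, R v ω * R w ω ∂P with hB
  have hi : ∀ v w, Integrable (fun ω => R v ω * R w ω) P := fun v w =>
    integrable_mul_of_hasGaussianLaw (hG v) (hG w)
  have hcomm : ∀ v w, B v w = B w v := fun v w => by simp only [hB, mul_comm]
  have hBadd : ∀ u v w, B (u + v) w = B u w + B v w := fun u v w => by
    simp only [hB, hadd, add_mul]; exact integral_add (hi _ _) (hi _ _)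
  have hBsub : ∀ u v w, B (u - v) w = B u w - B v w := fun u v w => by
    simp only [hB, hsub, sub_mul]; exact integral_sub (hi _ _) (hi _ _)
  have hBadd' : ∀ u v w, B w (u + v) = B w u + B w v := fun u v w => by
    rw [hcomm, hBadd, hcomm u, hcomm v]
  have hBsub' : ∀ u v w, B w (u - v) = B w u - B w v := fun u v w => by
    rw [hcomm, hBsub, hcomm u, hcomm v]
  have h4 : ∀ v, ∫ ω, R v ω ^ 4 ∂P = 3 * B v v ^ 2 := fun v => by
    rw [integral_pow_four_of_hasGaussianLaw (hG v) (h0 v)]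
    simp only [hB, pow_two]
  have i4 : ∀ v, Integrable (fun ω => R v ω ^ 4) P := fun v => by
    have := integrable_mul_mul_mul_of_hasGaussianLaw (hG v) (hG v) (hG v) (hG v)
    refine this.congr (ae_of_all _ fun ω => ?_)
    ring
  -- Polarization: the eight fourth powers, signed by the product of their signs, leave only the
  -- monomial `abcd`, with coefficient `8 · 4! = 192`. Each power is a fourth moment of one Gaussian
  -- variable of the family.
  have hpt : ∀ ω, R a ω * R b ω * (R c ω * R d ω) = (1 / 192 : ℝ) *
      (R (a + b + c + d) ω ^ 4 - R (a + b + c - d) ω ^ 4 - R (a + b - c + d) ω ^ 4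
        + R (a + b - c - d) ω ^ 4 - R (a - b + c + d) ω ^ 4 + R (a - b + c - d) ω ^ 4
        + R (a - b - c + d) ω ^ 4 - R (a - b - c - d) ω ^ 4) := by
    intro ω
    simp only [hadd, hsub]
    ring
  have e : ∫ ω, R a ω * R b ω * (R c ω * R d ω) ∂P = (1 / 192 : ℝ) *
      (3 * B (a + b + c + d) (a + b + c + d) ^ 2 - 3 * B (a + b + c - d) (a + b + c - d) ^ 2
        - 3 * B (a + b - c + d) (a + b - c + d) ^ 2
        + 3 * B (a + b - c - d) (a + b - c - d) ^ 2 - 3 * B (a - b + c + d) (a - b + c + d) ^ 2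
        + 3 * B (a - b + c - d) (a - b + c - d) ^ 2
        + 3 * B (a - b - c + d) (a - b - c + d) ^ 2
        - 3 * B (a - b - c - d) (a - b - c - d) ^ 2) := by
    simp_rw [hpt]
    rw [integral_const_mul]
    simp only [← h4]
    rw [integral_sub, integral_add, integral_add, integral_sub, integral_add, integral_sub,
      integral_sub]
    all_goals
      first
      | exact i4 _
      | (repeat' first | exact i4 _ | apply Integrable.sub | apply Integrable.add)
  rw [e]
  change _ = B a b * B c d + B a c * B b d + B a d * B b c
  simp only [hBadd, hBsub, hBadd', hBsub']
  rw [hcomm b a, hcomm c a, hcomm d a, hcomm c b, hcomm d b, hcomm d c]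
  ring

end Gaussian

/-! ### A strong law of large numbers in continuous time. -/

section LargeNumbers

variable {Ω : Type*} [MeasurableSpace Ω] {P : Measure Ω}

/-- A pathwise continuous process with a.e.-measurable marginals agrees almost surely, at all
times, with a pathwise continuous process with measurable marginals. -/
theorem exists_measurable_continuous_modification (Z : ℝ → Ω → ℝ)
    (hc : ∀ ω, Continuous fun s => Z s ω) (hm : ∀ s, AEMeasurable (Z s) P) :
    ∃ Z' : ℝ → Ω → ℝ, (∀ ω, Continuous fun s => Z' s ω) ∧ (∀ s, Measurable (Z' s)) ∧
      ∀ᵐ ω ∂P, ∀ s, Z' s ω = Z s ω := by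
  have hbad : ∀ᵐ ω ∂P, ∀ q : ℚ, Z q ω = (hm q).mk (Z q) ω :=
    ae_all_iff.2 fun q => (hm q).ae_eq_mk
  -- A measurable null hull of the bad event. Setting the process to 0 on it keeps every path
  -- continuous and makes the rational times measurable; the other times are limits of these.
  set N := toMeasurable P {ω | ¬ ∀ q : ℚ, Z q ω = (hm q).mk (Z q) ω} with hN
  have hN0 : P N = 0 := by rw [hN, measure_toMeasurable]; exact hbad
  have hNm : MeasurableSet N := measurableSet_toMeasurable _ _
  have hgood : ∀ ω, ω ∉ N → ∀ q : ℚ, Z q ω = (hm q).mk (Z q) ω := by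
    intro ω hω
    by_contra h
    exact hω (subset_toMeasurable _ _ h)
  refine ⟨fun s => Nᶜ.indicator (Z s), fun ω => ?_, fun s => ?_, ?_⟩
  · by_cases h : ω ∈ N
    · simpa [h] using continuous_const
    · simpa [h] using hc ω
  · have hq : ∀ q : ℚ, Measurable (Nᶜ.indicator (Z q)) := by
      intro q
      have : Nᶜ.indicator (Z q) = Nᶜ.indicator ((hm q).mk (Z q)) := by
        ext ω
        by_cases h : ω ∈ N
        · simp [h]
        · simp [h, hgood ω h q]
      rw [this]
      exact (hm q).measurable_mk.indicator hNm.compl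
    obtain ⟨u, hu⟩ : ∃ u : ℕ → ℚ, Tendsto (fun n => (u n : ℝ)) atTop (𝓝 s) := by
      have : s ∈ closure (range ((↑) : ℚ → ℝ)) := Rat.denseRange_cast s
      obtain ⟨v, hv, hv'⟩ := mem_closure_iff_seq_limit.1 this
      choose u hu using hv
      exact ⟨u, by simpa only [hu] using hv'⟩
    refine measurable_of_tendsto_metrizable (fun n => hq (u n)) ?_
    refine tendsto_pi_nhds.2 fun ω => ?_
    by_cases h : ω ∈ N
    · simp [h]
    · simpa [h, Function.comp_def] using ((hc ω).tendsto s).comp hu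
  · have : ∀ᵐ ω ∂P, ω ∉ N := measure_eq_zero_iff_ae_notMem.1 hN0
    filter_upwards [this] with ω hω s
    simp [hω]

/-- By monotone convergence the sum of the series has finite expectation, hence is almost surely
finite, and its terms tend to 0. -/
theorem ae_tendsto_zero_of_summable_integral {X : ℕ → Ω → ℝ} (hX : ∀ n ω, 0 ≤ X n ω)
    (hi : ∀ n, Integrable (X n) P) (hs : Summable fun n => ∫ ω, X n ω ∂P) :
    ∀ᵐ ω ∂P, Tendsto (fun n => X n ω) atTop (𝓝 0) := by
  have h1 : ∫⁻ ω, ∑' n, ENNReal.ofReal (X n ω) ∂P ≠ ⊤ := by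
    rw [lintegral_tsum fun n => (hi n).aemeasurable.ennreal_ofReal]
    have : ∀ n, ∫⁻ ω, ENNReal.ofReal (X n ω) ∂P = ENNReal.ofReal (∫ ω, X n ω ∂P) := fun n =>
      (ofReal_integral_eq_lintegral_ofReal (hi n) (ae_of_all _ (hX n))).symm
    simp_rw [this]
    exact hs.tsum_ofReal_ne_top
  have hmeas : AEMeasurable (fun ω => ∑' n, ENNReal.ofReal (X n ω)) P :=
    AEMeasurable.tsum fun n => (hi n).aemeasurable.ennreal_ofReal
  filter_upwards [ae_lt_top' hmeas h1] with ω hω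
  have := ENNReal.tendsto_atTop_zero_of_tsum_ne_top hω.ne
  have h2 := (ENNReal.tendsto_toReal ENNReal.zero_ne_top).comp this
  simpa [Function.comp_def, ENNReal.toReal_ofReal (hX _ ω)] using h2

/-- Second moment of the time integral of a process. -/
theorem integral_sq_intervalIntegral [IsProbabilityMeasure P] {Y : ℝ → Ω → ℝ}
    (hc : ∀ ω, Continuous fun s => Y s ω) (hm : ∀ s, Measurable (Y s)) {a b K : ℝ} (hab : a ≤ b)
    (hL : ∀ s ∈ Icc a b, MemLp (Y s) 2 P) (hK : ∀ s ∈ Icc a b, ∫ ω, Y s ω ^ 2 ∂P ≤ K) :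
    Integrable (fun ω => (∫ s in a..b, Y s ω) ^ 2) P ∧
      ∫ ω, (∫ s in a..b, Y s ω) ^ 2 ∂P
        = ∫ s in Ioc a b, ∫ t in Ioc a b, ∫ ω, Y s ω * Y t ω ∂P := by
  set μ := (volume : Measure ℝ).restrict (Ioc a b) with hμ
  have hu : Measurable (Function.uncurry Y) := measurable_uncurry_of_continuous_of_measurable hc hm
  have hpm : Measurable fun p : Ω × (ℝ × ℝ) => Y p.2.1 p.1 * Y p.2.2 p.1 :=
    (hu.comp ((measurable_fst.comp measurable_snd).prodMk measurable_fst)).mul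
      (hu.comp ((measurable_snd.comp measurable_snd).prodMk measurable_fst))
  have hmem : ∀ᵐ p ∂(μ.prod μ), p.1 ∈ Ioc a b ∧ p.2 ∈ Ioc a b := by
    have : μ.prod μ = (volume.prod volume).restrict (Ioc a b ×ˢ Ioc a b) := by
      rw [hμ, Measure.prod_restrict]
    rw [this]
    exact ae_restrict_mem (measurableSet_Ioc.prod measurableSet_Ioc)
  -- Joint integrability for Fubini: `|Y_s Y_t| ≤ (Y_s² + Y_t²)/2` bounds the inner expectation by
  -- `K`, and the time square has finite measure.
  have hint : Integrable (fun p : Ω × (ℝ × ℝ) => Y p.2.1 p.1 * Y p.2.2 p.1) (P.prod (μ.prod μ)) := by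
    rw [integrable_prod_iff' hpm.aestronglyMeasurable]
    constructor
    · filter_upwards [hmem] with p hp
      exact (hL _ (Ioc_subset_Icc_self hp.1)).integrable_mul (hL _ (Ioc_subset_Icc_self hp.2))
    · refine Integrable.of_bound (C := K) ?_ ?_
      · exact (StronglyMeasurable.integral_prod_left' (μ := P)
          (hpm.norm.stronglyMeasurable)).aestronglyMeasurable
      · filter_upwards [hmem] with p hp
        have h1 := hL _ (Ioc_subset_Icc_self hp.1)
        have h2 := hL _ (Ioc_subset_Icc_self hp.2)
        rw [Real.norm_of_nonneg (integral_nonneg fun _ => norm_nonneg _)]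
        have : ∫ ω, ‖Y p.1 ω * Y p.2 ω‖ ∂P ≤ ∫ ω, (Y p.1 ω ^ 2 + Y p.2 ω ^ 2) / 2 ∂P := by
          refine integral_mono (h1.integrable_mul h2).norm
            ((h1.integrable_sq.add h2.integrable_sq).div_const 2) fun ω => ?_
          simp only [norm_mul, Real.norm_eq_abs]
          nlinarith [sq_nonneg (|Y p.1 ω| - |Y p.2 ω|), sq_abs (Y p.1 ω), sq_abs (Y p.2 ω)]
        refine this.trans ?_
        rw [integral_div, integral_add h1.integrable_sq h2.integrable_sq]
        linarith [hK _ (Ioc_subset_Icc_self hp.1), hK _ (Ioc_subset_Icc_self hp.2)]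
  have hsq : ∀ ω, (∫ s in a..b, Y s ω) ^ 2 = ∫ p, Y p.1 ω * Y p.2 ω ∂(μ.prod μ) := by
    intro ω
    rw [intervalIntegral.integral_of_le hab, pow_two, ← integral_prod_mul]
  simp_rw [hsq]
  refine ⟨hint.integral_prod_left, ?_⟩
  rw [integral_integral_swap hint]
  rw [integral_prod _ hint.integral_prod_right]

/-- Almost sure estimates are available at countably many times only. A general `T` lies between
consecutive squares, and the part of the integral beyond the lower one is bounded by the integral of
`|g|` over the whole gap. -/
theorem tendsto_average_zero_of_squares {g : ℝ → ℝ} (hg : Continuous g)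
    (h1 : Tendsto (fun n : ℕ => ((∫ s in (1 : ℝ)..((n : ℝ) ^ 2), g s) / (n : ℝ) ^ 2)) atTop (𝓝 0))
    (h2 : Tendsto (fun n : ℕ => ((∫ s in ((n : ℝ) ^ 2)..((n + 1 : ℝ) ^ 2), |g s|) / (n : ℝ) ^ 2))
      atTop (𝓝 0)) :
    Tendsto (fun Q : ℝ => (1 / Q) * ∫ s in Q..(2 * Q), g s) atTop (𝓝 0) := by
  have hI : ∀ a b : ℝ, IntervalIntegrable g volume a b := fun a b => hg.intervalIntegrable a b
  have hI' : ∀ a b : ℝ, IntervalIntegrable (fun s => |g s|) volume a b := fun a b =>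
    hg.abs.intervalIntegrable a b
  have hF : Tendsto (fun T : ℝ => (∫ s in (1 : ℝ)..T, g s) / T) atTop (𝓝 0) := by
    have hfl : Tendsto (fun T : ℝ => ⌊√T⌋₊) atTop atTop :=
      tendsto_nat_floor_atTop.comp Real.tendsto_sqrt_atTop
    have h3 := (h1.abs.add h2).comp hfl
    simp only [abs_zero, add_zero] at h3
    refine squeeze_zero_norm' ?_ h3
    filter_upwards [eventually_ge_atTop 1] with T hT
    set n := ⌊√T⌋₊ with hn
    have hs1 : (n : ℝ) ≤ √T := Nat.floor_le (Real.sqrt_nonneg _)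
    have hs2 : √T < n + 1 := Nat.lt_floor_add_one _
    have hn1 : (1 : ℝ) ≤ n := by
      have : 1 ≤ n := Nat.le_floor (by simpa using Real.one_le_sqrt.2 hT)
      exact_mod_cast this
    have hT0 : 0 ≤ T := by linarith
    have ha : (n : ℝ) ^ 2 ≤ T := by
      calc (n : ℝ) ^ 2 ≤ √T ^ 2 := by gcongr
        _ = T := Real.sq_sqrt hT0
    have hb : T ≤ ((n : ℝ) + 1) ^ 2 := by
      calc T = √T ^ 2 := (Real.sq_sqrt hT0).symm
        _ ≤ _ := by gcongr
    have hsplit : ∫ s in (1 : ℝ)..T, g s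
        = (∫ s in (1 : ℝ)..((n : ℝ) ^ 2), g s) + ∫ s in ((n : ℝ) ^ 2)..T, g s :=
      (intervalIntegral.integral_add_adjacent_intervals (hI _ _) (hI _ _)).symm
    have hrest : |∫ s in ((n : ℝ) ^ 2)..T, g s| ≤ ∫ s in ((n : ℝ) ^ 2)..((n : ℝ) + 1) ^ 2, |g s| := by
      refine (intervalIntegral.abs_integral_le_integral_abs ha).trans ?_
      exact intervalIntegral.integral_mono_interval le_rfl ha hb
        (ae_of_all _ fun _ => abs_nonneg _) (hI' _ _)
    have hpos : (0 : ℝ) < (n : ℝ) ^ 2 := by positivity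
    change ‖_‖ ≤ |(∫ s in (1 : ℝ)..((n : ℝ) ^ 2), g s) / (n : ℝ) ^ 2|
      + (∫ s in ((n : ℝ) ^ 2)..((n + 1 : ℝ) ^ 2), |g s|) / (n : ℝ) ^ 2
    rw [Real.norm_eq_abs, abs_div, abs_div, abs_of_pos hpos, ← add_div, abs_of_pos (by linarith : 0 < T), hsplit]
    refine div_le_div₀ ?_ ((abs_add_le _ _).trans (by gcongr)) hpos ha
    exact add_nonneg (abs_nonneg _) (intervalIntegral.integral_nonneg (by gcongr; linarith)
      fun _ _ => abs_nonneg _)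
  -- With `F(T) = T⁻¹ ∫_1^T g`, the band average over `[Q, 2Q]` is `2 F(2Q) - F(Q)`.
  have h2T : Tendsto (fun Q : ℝ => 2 * Q) atTop atTop :=
    tendsto_id.const_mul_atTop (by norm_num)
  have := ((hF.comp h2T).const_mul 2).sub hF
  simp only [mul_zero, sub_zero] at this
  refine this.congr' ?_
  filter_upwards [eventually_gt_atTop 0] with Q hQ
  have hsplit := intervalIntegral.integral_interval_sub_left (hI 1 (2 * Q)) (hI 1 Q)
  rw [← hsplit]
  simp only [Function.comp]
  field_simp

/-- A law of large numbers for a continuous-time process with decaying correlations. -/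
theorem ae_tendsto_average_zero [IsProbabilityMeasure P] (Z : ℝ → Ω → ℝ)
    (hc : ∀ ω, Continuous fun s => Z s ω) (hL : ∀ s, MemLp (Z s) 2 P) {C : ℝ}
    (hC : ∀ s t, 1 ≤ s → 1 ≤ t →
      |∫ ω, Z s ω * Z t ω ∂P| ≤ C * ((1 + (s - t) ^ 2)⁻¹ + (s ^ 2)⁻¹ + (t ^ 2)⁻¹)) :
    ∀ᵐ ω ∂P, Tendsto (fun Q : ℝ => (1 / Q) * ∫ s in Q..(2 * Q), Z s ω) atTop (𝓝 0) := by
  obtain ⟨Y, hYc, hYm, hYZ⟩ := exists_measurable_continuous_modification Z hc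
    fun s => (hL s).aestronglyMeasurable.aemeasurable
  have hYZ' : ∀ s, Y s =ᵐ[P] Z s := fun s => by filter_upwards [hYZ] with ω hω using hω s
  have hYL : ∀ s, MemLp (Y s) 2 P := fun s => (memLp_congr_ae (hYZ' s)).2 (hL s)
  have hYC : ∀ s t, 1 ≤ s → 1 ≤ t →
      |∫ ω, Y s ω * Y t ω ∂P| ≤ C * ((1 + (s - t) ^ 2)⁻¹ + (s ^ 2)⁻¹ + (t ^ 2)⁻¹) := by
    intro s t hs ht
    have : ∫ ω, Y s ω * Y t ω ∂P = ∫ ω, Z s ω * Z t ω ∂P :=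
      integral_congr_ae ((hYZ' s).mul (hYZ' t))
    rw [this]
    exact hC s t hs ht
  suffices h : ∀ᵐ ω ∂P, Tendsto (fun Q : ℝ => (1 / Q) * ∫ s in Q..(2 * Q), Y s ω) atTop (𝓝 0) by
    filter_upwards [h, hYZ] with ω h1 h2
    simpa only [h2] using h1
  clear hYZ hYZ' hC hL hc
  have hC0 : 0 ≤ C := by
    have := (abs_nonneg _).trans (hYC 1 1 le_rfl le_rfl)
    norm_num at this
    linarith
  have hK : ∀ s, 1 ≤ s → ∫ ω, Y s ω ^ 2 ∂P ≤ 3 * C := by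
    intro s hs
    have h1 := (le_abs_self _).trans (hYC s s hs hs)
    have h2 : (s ^ 2)⁻¹ ≤ 1 := inv_le_one_of_one_le₀ (by nlinarith)
    simp only [pow_two] at h1 h2 ⊢
    simp only [sub_self, mul_zero, add_zero, inv_one] at h1
    nlinarith
  -- Linear growth: in the double integral of the correlation bound, `(1 + (s-t)²)⁻¹` contributes at
  -- most `π(T-1)`, and each inverse square at most `T-1`.
  have bS : ∀ T : ℝ, 1 ≤ T → ∫ ω, (∫ s in (1 : ℝ)..T, Y s ω) ^ 2 ∂P ≤ C * (Real.pi + 2) * T := by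
    intro T hT
    rw [(integral_sq_intervalIntegral hYc hYm hT (fun s _ => hYL s)
      (fun s hs => hK s hs.1)).2]
    have hinv : ∫ t in Ioc 1 T, (t ^ 2)⁻¹ ≤ 1 := by
      have h0 := integral_Ioi_rpow_of_lt (a := -2) (by norm_num) (c := 1) (by norm_num)
      have hi0 := integrableOn_Ioi_rpow_of_lt (a := -2) (by norm_num) (c := 1) (by norm_num)
      have he : ∀ t ∈ Ioi (1 : ℝ), t ^ (-2 : ℝ) = (t ^ 2)⁻¹ := by
        intro t ht
        rw [Real.rpow_neg (by linarith [mem_Ioi.1 ht])]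
        norm_num
      rw [setIntegral_congr_fun measurableSet_Ioi he] at h0
      rw [integrableOn_congr_fun he measurableSet_Ioi] at hi0
      refine (setIntegral_mono_set hi0 (ae_of_all _ fun t => by positivity)
        Ioc_subset_Ioi_self.eventuallyLE).trans ?_
      rw [h0]; norm_num
    have hint2 : IntegrableOn (fun t : ℝ => (t ^ 2)⁻¹) (Ioc 1 T) := by
      refine (ContinuousOn.integrableOn_Icc ?_).mono_set Ioc_subset_Icc_self
      exact (continuousOn_pow 2).inv₀ fun t ht => by have := ht.1; positivity
    have hint1 : ∀ s : ℝ, Integrable (fun t : ℝ => (1 + (s - t) ^ 2)⁻¹) := fun s =>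
      integrable_inv_one_add_sq.comp_sub_left s
    have hinner : ∀ s ∈ Ioc 1 T, ‖∫ t in Ioc 1 T, ∫ ω, Y s ω * Y t ω ∂P‖ ≤
        C * (Real.pi + (T - 1) * (s ^ 2)⁻¹ + 1) := by
      intro s hs
      have hconst : IntegrableOn (fun _ : ℝ => (s ^ 2)⁻¹) (Ioc 1 T) :=
        integrableOn_const (by simp)
      have hadd : IntegrableOn (fun t : ℝ => (1 + (s - t) ^ 2)⁻¹ + (s ^ 2)⁻¹) (Ioc 1 T) :=
        (hint1 s).integrableOn.add hconst
      have hdom : IntegrableOn (fun t : ℝ => C * ((1 + (s - t) ^ 2)⁻¹ + (s ^ 2)⁻¹ + (t ^ 2)⁻¹))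
          (Ioc 1 T) :=
        (hadd.add hint2).const_mul C
      refine (norm_integral_le_of_norm_le hdom ?_).trans ?_
      · filter_upwards [ae_restrict_mem measurableSet_Ioc] with t ht
        exact hYC s t hs.1.le ht.1.le
      · rw [integral_const_mul, integral_add hadd hint2,
          integral_add (hint1 s).integrableOn hconst]
        gcongr
        · refine (setIntegral_le_integral (hint1 s) (ae_of_all _ fun t => by positivity)).trans ?_
          rw [integral_sub_left_eq_self (fun t : ℝ => (1 + t ^ 2)⁻¹) volume s,
            integral_univ_inv_one_add_sq]
        · simp [hT]
    have hdom : IntegrableOn (fun s : ℝ => C * (Real.pi + (T - 1) * (s ^ 2)⁻¹ + 1)) (Ioc 1 T) := by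
      refine Integrable.const_mul ?_ C
      refine Integrable.add (Integrable.add ?_ (hint2.const_mul _)) ?_
      · exact integrableOn_const (by simp)
      · exact integrableOn_const (by simp)
    have hle := norm_integral_le_of_norm_le hdom
      ((ae_restrict_mem measurableSet_Ioc).mono fun s hs => hinner s hs)
    refine (le_abs_self _).trans (hle.trans ?_)
    · rw [integral_const_mul, integral_add, integral_add, integral_const_mul]
      · simp only [integral_const, MeasurableSet.univ, measureReal_restrict_apply, univ_inter,
          Real.volume_real_Ioc_of_le hT, smul_eq_mul, mul_one]
        have hp := Real.pi_pos
        have : (T - 1) * ∫ t in Ioc 1 T, (t ^ 2)⁻¹ ≤ (T - 1) * 1 := by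
          gcongr
        rw [mul_assoc]
        gcongr
        nlinarith
      · exact integrableOn_const (by simp)
      · exact hint2.const_mul _
      · exact Integrable.add (integrableOn_const (by simp)) (hint2.const_mul _)
      · exact integrableOn_const (by simp)
  have bW : ∀ a b : ℝ, 1 ≤ a → a ≤ b →
      Integrable (fun ω => (∫ s in a..b, |Y s ω|) ^ 2) P ∧
      ∫ ω, (∫ s in a..b, |Y s ω|) ^ 2 ∂P ≤ 3 * C * (b - a) ^ 2 := by
    intro a b ha hab
    have hLa : ∀ s, MemLp (fun ω => |Y s ω|) 2 P := fun s => (hYL s).abs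
    have hKa : ∀ s ∈ Icc a b, ∫ ω, |Y s ω| ^ 2 ∂P ≤ 3 * C := fun s hs => by
      simpa only [sq_abs] using hK s (ha.trans hs.1)
    obtain ⟨h1, h2⟩ := integral_sq_intervalIntegral (Y := fun s ω => |Y s ω|) (K := 3 * C)
      (fun ω => (hYc ω).abs) (fun s => (hYm s).abs) hab (fun s _ => hLa s) hKa
    refine ⟨h1, ?_⟩
    rw [h2]
    have hin : ∀ s ∈ Ioc a b, ∀ t ∈ Ioc a b, ‖∫ ω, |Y s ω| * |Y t ω| ∂P‖ ≤ 3 * C := by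
      intro s hs t ht
      rw [Real.norm_of_nonneg (integral_nonneg fun _ => by positivity)]
      have : ∫ ω, |Y s ω| * |Y t ω| ∂P ≤ ∫ ω, (|Y s ω| ^ 2 + |Y t ω| ^ 2) / 2 ∂P := by
        refine integral_mono ((hLa s).integrable_mul (hLa t))
          (((hLa s).integrable_sq.add (hLa t).integrable_sq).div_const 2) fun ω => ?_
        simp only
        nlinarith [sq_nonneg (|Y s ω| - |Y t ω|)]
      refine this.trans ?_
      rw [integral_div, integral_add (hLa s).integrable_sq (hLa t).integrable_sq]
      linarith [hKa s (Ioc_subset_Icc_self hs), hKa t (Ioc_subset_Icc_self ht)]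
    have hvol : volume.real (Ioc a b) = b - a := Real.volume_real_Ioc_of_le hab
    have h3 : ∀ s ∈ Ioc a b, ‖∫ t in Ioc a b, ∫ ω, |Y s ω| * |Y t ω| ∂P‖ ≤ 3 * C * (b - a) := by
      intro s hs
      rw [← hvol]
      exact norm_setIntegral_le_of_norm_le_const (by simp) (fun t ht => hin s hs t ht)
    have h4 := norm_setIntegral_le_of_norm_le_const (μ := volume) (s := Ioc a b) (by simp) h3
    rw [hvol] at h4
    exact (le_abs_self _).trans (h4.trans (by rw [pow_two, mul_assoc]))
  have hsum : Summable fun n : ℕ => (1 : ℝ) / (n : ℝ) ^ 2 := Real.summable_one_div_nat_pow.2 (by norm_num)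
  -- The reason for sampling at `T = n²`: a second moment of order `T` becomes, after division by
  -- `T²`, the summable `K/n²`.
  have key : ∀ (X : ℕ → Ω → ℝ) (K : ℝ), (∀ n, 1 ≤ n → Integrable (fun ω => X n ω ^ 2) P) →
      (∀ n : ℕ, 1 ≤ n → ∫ ω, X n ω ^ 2 ∂P ≤ K * (n : ℝ) ^ 2) →
      ∀ᵐ ω ∂P, Tendsto (fun n : ℕ => X n ω / (n : ℝ) ^ 2) atTop (𝓝 0) := by
    intro X K hi hb
    have hi' : ∀ n : ℕ, Integrable (fun ω => (X n ω / (n : ℝ) ^ 2) ^ 2) P := by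
      intro n
      rcases Nat.eq_zero_or_pos n with rfl | hn
      · simp
      · simp only [div_pow]
        exact (hi n hn).div_const _
    have := ae_tendsto_zero_of_summable_integral (X := fun n ω => (X n ω / (n : ℝ) ^ 2) ^ 2)
      (fun n ω => sq_nonneg _) hi' (by
        refine Summable.of_nonneg_of_le (fun n => integral_nonneg fun ω => sq_nonneg _) (fun n => ?_)
          (hsum.mul_left K)
        rcases Nat.eq_zero_or_pos n with rfl | hn
        · simp
        · simp only [div_pow]
          rw [integral_div]
          have hn' : (0 : ℝ) < n := by exact_mod_cast hn
          rw [div_le_iff₀ (by positivity)]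
          refine (hb n hn).trans (le_of_eq ?_)
          field_simp)
    filter_upwards [this] with ω hω
    have h5 := hω.sqrt
    simp only [Real.sqrt_sq_eq_abs, Real.sqrt_zero] at h5
    exact (tendsto_zero_iff_abs_tendsto_zero _).2 h5
  have k1 := key (fun n ω => ∫ s in (1 : ℝ)..((n : ℝ) ^ 2), Y s ω) (C * (Real.pi + 2))
    (fun n hn => by
      have hn' : (1 : ℝ) ≤ (n : ℝ) ^ 2 := by exact_mod_cast Nat.one_le_pow _ _ hn
      exact (integral_sq_intervalIntegral hYc hYm hn' (fun s _ => hYL s)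
        (fun s hs => hK s hs.1)).1)
    (fun n hn => by
      have hn' : (1 : ℝ) ≤ (n : ℝ) ^ 2 := by exact_mod_cast Nat.one_le_pow _ _ hn
      exact bS _ hn')
  -- The gap has length `2n + 1 ≤ 3n`, so `bW` gives `3C (3n)² = 27 C n²`.
  have k2 := key (fun n ω => ∫ s in ((n : ℝ) ^ 2)..((n + 1 : ℝ) ^ 2), |Y s ω|) (27 * C)
    (fun n hn => by
      have hn' : (1 : ℝ) ≤ (n : ℝ) ^ 2 := by exact_mod_cast Nat.one_le_pow _ _ hn
      exact (bW _ _ hn' (by gcongr; linarith)).1)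
    (fun n hn => by
      have hn' : (1 : ℝ) ≤ (n : ℝ) ^ 2 := by exact_mod_cast Nat.one_le_pow _ _ hn
      have hn1 : (1 : ℝ) ≤ n := by exact_mod_cast hn
      refine (bW _ _ hn' (by gcongr; linarith)).2.trans ?_
      have : ((n + 1 : ℝ) ^ 2 - (n : ℝ) ^ 2) ^ 2 ≤ 9 * (n : ℝ) ^ 2 := by nlinarith
      nlinarith)
  filter_upwards [k1, k2] with ω h1 h2
  exact tendsto_average_zero_of_squares (hYc ω) h1 h2

end LargeNumbers

/-! ### Continuity of cut-off plane waves in the frequency. -/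

section PlaneWaves

/-- Joint continuity of the partial derivatives of all orders is what makes them converge uniformly
on compact sets as the parameter varies. -/
theorem contDiff_iteratedFDeriv_uncurry {E F G : Type*} [NormedAddCommGroup E] [NormedSpace ℝ E]
    [NormedAddCommGroup F] [NormedSpace ℝ F] [NormedAddCommGroup G] [NormedSpace ℝ G]
    {f : E → F → G} (hf : ContDiff ℝ ((⊤ : ℕ∞) : WithTop ℕ∞) (Function.uncurry f)) (i : ℕ) :
    ContDiff ℝ ((⊤ : ℕ∞) : WithTop ℕ∞) fun p : E × F => iteratedFDeriv ℝ i (f p.1) p.2 := by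
  induction i with
  | zero =>
    simp only [iteratedFDeriv_zero_eq_comp, Function.comp]
    exact (continuousMultilinearCurryFin0 ℝ F G).symm.contDiff.comp hf
  | succ i ih =>
    simp only [iteratedFDeriv_succ_eq_comp_left, Function.comp]
    have hder : ContDiff ℝ ((⊤ : ℕ∞) : WithTop ℕ∞)
        fun p : E × F => fderiv ℝ (iteratedFDeriv ℝ i (f p.1)) p.2 :=
      ContDiff.fderiv (f := fun (p : E × F) y => iteratedFDeriv ℝ i (f p.1) y)
        (g := Prod.snd) (m := ((⊤ : ℕ∞) : WithTop ℕ∞))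
        (ih.comp ((contDiff_fst.comp contDiff_fst).prodMk contDiff_snd)) contDiff_snd (by simp)
    exact hder.continuousLinearMap_comp
      ((continuousMultilinearCurryLeftEquiv ℝ (fun _ : Fin (i + 1) => F) G).symm :
        _ →L[ℝ] F [×(i + 1)]→L[ℝ] G)

/-- A family of test functions with supports in a common compact set that is jointly smooth in the
parameter and the space variable is continuous in the topology of test functions. -/
theorem continuous_testFun_of_contDiff_uncurry {d : ℕ} (φ : ℝ → TestFun d)
    (K : TopologicalSpace.Compacts (Space d)) (hK : ∀ κ, ∀ y ∉ K, φ κ y = 0)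
    (hφ : ContDiff ℝ ((⊤ : ℕ∞) : WithTop ℕ∞) (Function.uncurry fun κ y => φ κ y)) :
    Continuous φ := by
  -- The family factors through the functions supported in the fixed compact `K`, where the topology
  -- is that of uniform convergence of each derivative.
  let ψ : ℝ → ContDiffMapSupportedIn (Space d) ℂ ⊤ K := fun κ =>
    { toFun := φ κ
      contDiff' := (φ κ).contDiff
      zero_on_compl' := fun y hy => hK κ y hy }
  have hψ : φ = fun κ => TestFunction.ofSupportedIn (Ω := ⊤) (subset_univ _) (ψ κ) := by
    funext κ; ext y; rfl
  rw [hψ]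
  refine (TestFunction.continuous_ofSupportedIn _).comp ?_
  rw [ContDiffMapSupportedIn.continuous_iff_comp]
  intro i
  have hcont : Continuous fun p : ℝ × Space d => iteratedFDeriv ℝ i (φ p.1) p.2 :=
    (contDiff_iteratedFDeriv_uncurry (f := fun κ y => φ κ y) hφ i).continuous
  have happ : ∀ κ y, ContDiffMapSupportedIn.structureMapCLM ℝ ⊤ i (ψ κ) y
      = iteratedFDeriv ℝ i (φ κ) y := fun κ y => by
    rw [ContDiffMapSupportedIn.structureMapCLM_top_apply]; rfl
  rw [continuous_iff_continuousAt]
  intro κ₀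
  rw [ContinuousAt, Metric.tendsto_nhds]
  intro ε hε
  have hev : ∀ᶠ κ in 𝓝 κ₀, ∀ y ∈ (K : Set (Space d)),
      dist (iteratedFDeriv ℝ i (φ κ) y) (iteratedFDeriv ℝ i (φ κ₀) y) < ε / 2 := by
    refine K.isCompact.eventually_forall_of_forall_eventually fun y _ => ?_
    have h1 : Continuous fun p : ℝ × Space d =>
        dist (iteratedFDeriv ℝ i (φ p.1) p.2) (iteratedFDeriv ℝ i (φ κ₀) p.2) :=
      hcont.dist (hcont.comp (continuous_const.prodMk continuous_snd))
    exact (h1.tendsto (κ₀, y)).eventually_lt_const (by simp [hε])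
  filter_upwards [hev] with κ hκ
  refine lt_of_le_of_lt ?_ (half_lt_self hε)
  rw [BoundedContinuousFunction.dist_le (by positivity)]
  intro y
  simp only [Function.comp, happ]
  by_cases hy : y ∈ (K : Set (Space d))
  · exact (hκ y hy).le
  · rw [← happ, ← happ, ContDiffMapSupportedIn.structureMapCLM_top_apply,
      ContDiffMapSupportedIn.structureMapCLM_top_apply,
      (ψ κ).iteratedFDeriv_zero_on_compl hy, (ψ κ₀).iteratedFDeriv_zero_on_compl hy]
    simp only [Pi.zero_apply, dist_self]
    positivity

theorem cutPlaneWave_apply {d : ℕ} (χ : TestFun d) (x : Space d) (κ : ℝ) (y : Space d) :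
    cutPlaneWave χ x κ y = χ y * Complex.exp (-(Complex.I * ((κ * inner ℝ x y : ℝ) : ℂ))) := rfl

/-- Since a distribution is continuous on test functions, this gives continuous sample paths in the
frequency, as the law of large numbers requires. -/
theorem continuous_cutPlaneWave {d : ℕ} (χ : TestFun d) (x : Space d) :
    Continuous fun κ => cutPlaneWave χ x κ := by
  refine continuous_testFun_of_contDiff_uncurry _ ⟨tsupport χ, χ.hasCompactSupport⟩ ?_ ?_
  · intro κ y hy
    rw [cutPlaneWave_apply, image_eq_zero_of_notMem_tsupport hy, zero_mul]
  · change ContDiff ℝ _ fun p : ℝ × Space d =>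
      χ p.2 * Complex.exp (-(Complex.I * ((p.1 * inner ℝ x p.2 : ℝ) : ℂ)))
    refine (χ.contDiff.comp contDiff_snd).mul (ContDiff.cexp (ContDiff.neg (contDiff_const.mul ?_)))
    exact Complex.ofRealCLM.contDiff.comp
      (contDiff_fst.mul (contDiff_const.inner ℝ contDiff_snd))

end PlaneWaves

/-! ### Pseudo-differential operators on wave packets. -/

section Symbols

variable {d : ℕ}

theorem rpow_le_rpow_abs_mul_rpow {x y A p : ℝ} (hx : 0 < x) (hy : 0 < y) (hA : 0 < A)
    (h1 : x ≤ A * y) (h2 : y ≤ A * x) : x ^ p ≤ A ^ |p| * y ^ p := by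
  rcases le_total 0 p with hp | hp
  · rw [abs_of_nonneg hp, ← Real.mul_rpow hA.le hy.le]
    exact Real.rpow_le_rpow hx.le h1 hp
  · rw [abs_of_nonpos hp]
    have h3 : y / A ≤ x := by rw [div_le_iff₀ hA]; linarith
    refine (Real.rpow_le_rpow_of_nonpos (by positivity) h3 hp).trans (le_of_eq ?_)
    rw [Real.div_rpow hy.le hA.le, Real.rpow_neg hA.le, div_eq_mul_inv, mul_comm]

/-- Peetre's inequality. -/
theorem one_add_norm_add_rpow_le {E : Type*} [NormedAddCommGroup E] (k η : E) (p : ℝ) :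
    (1 + ‖k + η‖) ^ p ≤ (1 + ‖η‖) ^ |p| * (1 + ‖k‖) ^ p := by
  have h1 := norm_add_le k η
  have h2 := norm_sub_le (k + η) η
  rw [add_sub_cancel_right] at h2
  have hk := norm_nonneg k
  have hη := norm_nonneg η
  have hs := norm_nonneg (k + η)
  refine rpow_le_rpow_abs_mul_rpow ?_ ?_ ?_ ?_ ?_ <;> nlinarith

theorem norm_cexp_I_mul_ofReal (t : ℝ) : ‖Complex.exp (Complex.I * (t : ℂ))‖ = 1 := by
  rw [mul_comm, Complex.norm_exp_ofReal_mul_I]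

theorem norm_cexp_neg_I_mul_ofReal (t : ℝ) : ‖Complex.exp (-(Complex.I * (t : ℂ)))‖ = 1 := by
  rw [← norm_cexp_I_mul_ofReal (-t)]; congr 2; push_cast; ring

theorem fourierT_eq_fourier (g : Space d → ℂ) (ξ : Space d) :
    fourierT g ξ = FourierTransform.fourier g ((2 * Real.pi)⁻¹ • ξ) := by
  rw [Real.fourier_eq', fourierT]
  refine integral_congr_ae (ae_of_all _ fun x => ?_)
  simp only [smul_eq_mul, inner_smul_right]
  congr 2
  have : -2 * Real.pi * ((2 * Real.pi)⁻¹ * inner ℝ x ξ) = -inner ℝ x ξ := by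
    field_simp
  rw [this]
  push_cast; ring

/-- A linear rescaling of the frequency passes between the two Fourier conventions and preserves
Schwartz functions. Decay, continuity and weighted integrability of `fourierT` all come from here.
-/
theorem exists_schwartzMap_eq_fourierT {g : Space d → ℂ}
    (hg : ContDiff ℝ ((⊤ : ℕ∞) : WithTop ℕ∞) g) (hc : HasCompactSupport g) :
    ∃ S : SchwartzMap (Space d) ℂ, ∀ ξ, S ξ = fourierT g ξ := by
  have h0 : (2 * Real.pi)⁻¹ ≠ 0 := by positivity
  let e := (LinearEquiv.smulOfNeZero ℝ (Space d) _ h0).toContinuousLinearEquiv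
  refine ⟨SchwartzMap.compCLMOfContinuousLinearEquiv ℂ e
    (FourierTransform.fourier (hc.toSchwartzMap hg)), fun ξ => ?_⟩
  rw [fourierT_eq_fourier]
  rfl

theorem integral_cexp_mul_fourierT {g : Space d → ℂ}
    (hg : ContDiff ℝ ((⊤ : ℕ∞) : WithTop ℕ∞) g) (hc : HasCompactSupport g) (x : Space d) :
    ∫ ξ, Complex.exp (Complex.I * ((inner ℝ x ξ : ℝ) : ℂ)) * fourierT g ξ
      = (((2 * Real.pi) ^ d : ℝ) : ℂ) * g x := by
  have h1 := Measure.integral_comp_smul (volume : Measure (Space d))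
    (fun ξ => Complex.exp (Complex.I * ((inner ℝ x ξ : ℝ) : ℂ)) * fourierT g ξ) (2 * Real.pi)
  have h2 : ∫ w, Complex.exp (Complex.I * ((inner ℝ x ((2 * Real.pi) • w) : ℝ) : ℂ))
      * fourierT g ((2 * Real.pi) • w) = g x := by
    have h3 : FourierTransformInv.fourierInv (FourierTransform.fourier (hc.toSchwartzMap hg)) x
        = g x := by
      rw [FourierTransform.fourierInv_fourier_eq]; rfl
    rw [SchwartzMap.fourierInv_coe, Real.fourierInv_eq'] at h3
    rw [← h3]
    refine integral_congr_ae (ae_of_all _ fun w => ?_)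
    simp only [smul_eq_mul]
    rw [fourierT_eq_fourier, smul_smul, inv_mul_cancel₀ (by positivity), one_smul, inner_smul_right,
      real_inner_comm, SchwartzMap.fourier_coe]
    congr 2
    push_cast; ring
  rw [h2, finrank_euclideanSpace, Fintype.card_fin, abs_of_pos (by positivity)] at h1
  rw [h1, Complex.real_smul, ← mul_assoc, ← Complex.ofReal_mul,
    mul_inv_cancel₀ (by positivity), Complex.ofReal_one, one_mul]

theorem integrable_one_add_norm_pow_mul_schwartzMap (S : SchwartzMap (Space d) ℂ) (N : ℕ) :
    Integrable fun η => (1 + ‖η‖) ^ N * ‖S η‖ := by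
  simp_rw [add_comm (1 : ℝ), add_pow, one_pow, mul_one, Finset.sum_mul]
  refine integrable_finsetSum _ fun k _ => ?_
  refine ((S.integrable_pow_mul volume k).const_mul ((N.choose k : ℕ) : ℝ)).congr
    (ae_of_all _ fun η => ?_)
  ring

theorem norm_fderiv_le_of_isSymbol {r : ℝ} {σ : Space d → Space d → ℂ} (hσ : IsSymbol r σ) :
    ∃ C, 0 ≤ C ∧ ∀ x ξ, ‖fderiv ℝ (σ x) ξ‖ ≤ C * (1 + ‖ξ‖) ^ (r - 1) := by
  obtain ⟨C, hC, h⟩ := hσ.2 1 0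
  refine ⟨C, hC.le, fun x ξ => ?_⟩
  have := h x ξ
  rw [Nat.cast_one] at this
  rw [← norm_iteratedFDeriv_one]
  refine le_trans (le_of_eq ?_) this
  exact (LinearIsometryEquiv.norm_iteratedFDeriv_comp_left
    (continuousMultilinearCurryFin0 ℝ (Space d) ℂ).symm (σ x) ξ 1).symm

theorem norm_le_of_isSymbol {r : ℝ} {σ : Space d → Space d → ℂ} (hσ : IsSymbol r σ) :
    ∃ C, 0 ≤ C ∧ ∀ x ξ, ‖σ x ξ‖ ≤ C * (1 + ‖ξ‖) ^ r := by
  obtain ⟨C, hC, h⟩ := hσ.2 0 0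
  refine ⟨C, hC.le, fun x ξ => ?_⟩
  simpa using h x ξ

/-- Mean value inequality on the segment from `k` to `k + η`, where a `ξ`-derivative gains one
order; Peetre's inequality moves the weight back to `k` at a polynomial cost in `η`. -/
theorem norm_sub_le_of_isSymbol {r : ℝ} {σ : Space d → Space d → ℂ} (hσ : IsSymbol r σ) :
    ∃ C, 0 ≤ C ∧ ∀ x k η, ‖σ x (k + η) - σ x k‖
      ≤ C * (1 + ‖k‖) ^ (r - 1) * ((1 + ‖η‖) ^ |r - 1| * ‖η‖) := by
  obtain ⟨C, hC, h⟩ := norm_fderiv_le_of_isSymbol hσ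
  refine ⟨C, hC, fun x k η => ?_⟩
  have hdiff : Differentiable ℝ (σ x) :=
    (hσ.1.comp (contDiff_const.prodMk contDiff_id)).differentiable (by simp)
  have hb : ∀ ζ ∈ segment ℝ k (k + η),
      ‖fderiv ℝ (σ x) ζ‖ ≤ C * ((1 + ‖η‖) ^ |r - 1| * (1 + ‖k‖) ^ (r - 1)) := by
    intro ζ hζ
    rw [segment_eq_image'] at hζ
    obtain ⟨t, ht, rfl⟩ := hζ
    refine (h x _).trans (mul_le_mul_of_nonneg_left ?_ hC)
    refine (one_add_norm_add_rpow_le _ _ _).trans ?_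
    have : ‖t • (k + η - k)‖ ≤ ‖η‖ := by
      rw [add_sub_cancel_left, norm_smul, Real.norm_of_nonneg ht.1]
      exact mul_le_of_le_one_left (norm_nonneg _) ht.2
    gcongr
  have := (convex_segment k (k + η)).norm_image_sub_le_of_norm_fderiv_le
    (fun ζ _ => hdiff ζ) hb (left_mem_segment ℝ _ _) (right_mem_segment ℝ _ _)
  rw [add_sub_cancel_left] at this
  refine this.trans (le_of_eq (by ring))

theorem fourierT_mul_cexp {g φ : Space d → ℂ} {k : Space d}
    (hφ : ∀ y, φ y = g y * Complex.exp (Complex.I * ((inner ℝ k y : ℝ) : ℂ))) (ξ : Space d) :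
    fourierT φ ξ = fourierT g (ξ - k) := by
  simp only [fourierT]
  refine integral_congr_ae (ae_of_all _ fun y => ?_)
  simp only [hφ, inner_sub_right, real_inner_comm k y]
  rw [mul_comm (g y), ← mul_assoc, ← Complex.exp_add]
  congr 2
  push_cast; ring

/-- A pseudo-differential operator acts on a wave packet of frequency `k` as multiplication by the
symbol frozen at `k`, up to an error of one order less. -/
theorem norm_pseudoDiff_sub_le {r : ℝ} {σ : Space d → Space d → ℂ} (hσ : IsSymbol r σ)
    (g : TestFun d) :
    ∃ C, 0 ≤ C ∧ ∀ (k : Space d) (φ : TestFun d),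
      (∀ y, φ y = g y * Complex.exp (Complex.I * ((inner ℝ k y : ℝ) : ℂ))) → ∀ y,
      ‖pseudoDiff σ φ y - Complex.exp (Complex.I * ((inner ℝ y k : ℝ) : ℂ)) * σ y k * g y‖
        ≤ C * (1 + ‖k‖) ^ (r - 1) := by
  obtain ⟨C, hC, h⟩ := norm_sub_le_of_isSymbol hσ
  obtain ⟨S, hS⟩ := exists_schwartzMap_eq_fourierT g.contDiff g.hasCompactSupport
  -- An integer power dominating Peetre's factor; one more power of `1 + ‖η‖` absorbs the factor
  -- `‖η‖`.
  set N := ⌈|r - 1|⌉₊ with hN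
  have hI := integrable_one_add_norm_pow_mul_schwartzMap S (N + 1)
  set c : ℝ := (2 * Real.pi) ^ d with hc
  have hcpos : 0 < c := by positivity
  refine ⟨c⁻¹ * (C * ∫ η, (1 + ‖η‖) ^ (N + 1) * ‖S η‖), ?_, fun k φ hφ y => ?_⟩
  · have := integral_nonneg (μ := (volume : Measure (Space d)))
      (f := fun η => (1 + ‖η‖) ^ (N + 1) * ‖S η‖) fun η => by positivity
    positivity
  have hσc : Continuous (σ y) := (hσ.1.comp (contDiff_const.prodMk contDiff_id)).continuous
  have hexp : Continuous fun η : Space d => Complex.exp (Complex.I * ((inner ℝ y η : ℝ) : ℂ)) := by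
    fun_prop
  have hpt : ∀ η, ‖Complex.exp (Complex.I * ((inner ℝ y η : ℝ) : ℂ)) * (σ y (k + η) - σ y k) * S η‖
      ≤ C * (1 + ‖k‖) ^ (r - 1) * ((1 + ‖η‖) ^ (N + 1) * ‖S η‖) := by
    intro η
    rw [norm_mul, norm_mul, norm_cexp_I_mul_ofReal, one_mul, ← mul_assoc]
    refine mul_le_mul_of_nonneg_right ((h y k η).trans ?_) (norm_nonneg _)
    gcongr
    rw [pow_succ]
    have h1 : (1 : ℝ) ≤ 1 + ‖η‖ := by linarith [norm_nonneg η]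
    gcongr
    · rw [← Real.rpow_natCast]
      exact Real.rpow_le_rpow_of_exponent_le h1 (Nat.le_ceil _)
    · linarith
  have hI1 : Integrable fun η =>
      Complex.exp (Complex.I * ((inner ℝ y η : ℝ) : ℂ)) * (σ y (k + η) - σ y k) * S η := by
    refine (hI.const_mul (C * (1 + ‖k‖) ^ (r - 1))).mono' ?_ (ae_of_all _ hpt)
    exact ((hexp.mul ((hσc.comp (continuous_const.add continuous_id)).sub continuous_const)).mul
      S.continuous).aestronglyMeasurable
  have hI2 : Integrable fun η =>
      Complex.exp (Complex.I * ((inner ℝ y η : ℝ) : ℂ)) * S η := by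
    refine S.integrable.norm.mono' (hexp.mul S.continuous).aestronglyMeasurable
      (ae_of_all _ fun η => ?_)
    rw [norm_mul, norm_cexp_I_mul_ofReal, one_mul]
  have hinv : ∫ η, Complex.exp (Complex.I * ((inner ℝ y η : ℝ) : ℂ)) * S η = (c : ℂ) * g y := by
    simp_rw [hS]
    exact integral_cexp_mul_fourierT g.contDiff g.hasCompactSupport y
  -- Since `φ̂(ξ) = ĝ(ξ - k)`, substitute `ξ = k + η` and split off `σ(y, k)`; its integral against
  -- `ĝ` is evaluated by Fourier inversion.
  have hps : pseudoDiff σ φ y = (c : ℂ)⁻¹ * (Complex.exp (Complex.I * ((inner ℝ y k : ℝ) : ℂ)) *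
      ((∫ η, Complex.exp (Complex.I * ((inner ℝ y η : ℝ) : ℂ)) * (σ y (k + η) - σ y k) * S η)
        + σ y k * ((c : ℂ) * g y))) := by
    rw [← hinv, ← integral_const_mul, ← integral_add hI1 (hI2.const_mul _), ← integral_const_mul,
      pseudoDiff, ← integral_add_left_eq_self _ k]
    congr 1
    refine integral_congr_ae (ae_of_all _ fun η => ?_)
    simp only [fourierT_mul_cexp hφ, add_sub_cancel_left, hS, inner_add_right, Complex.ofReal_add,
      mul_add, Complex.exp_add]
    ring
  have hcc : (c : ℂ) ≠ 0 := by exact_mod_cast hcpos.ne'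
  have heq : pseudoDiff σ φ y - Complex.exp (Complex.I * ((inner ℝ y k : ℝ) : ℂ)) * σ y k * g y
      = (c : ℂ)⁻¹ * (Complex.exp (Complex.I * ((inner ℝ y k : ℝ) : ℂ)) *
      ∫ η, Complex.exp (Complex.I * ((inner ℝ y η : ℝ) : ℂ)) * (σ y (k + η) - σ y k) * S η) := by
    rw [hps]
    field_simp
    ring
  rw [heq, norm_mul, norm_mul, norm_cexp_I_mul_ofReal, one_mul, norm_inv, Complex.norm_real,
    Real.norm_of_nonneg hcpos.le]
  have := norm_integral_le_of_norm_le (hI.const_mul (C * (1 + ‖k‖) ^ (r - 1))) (ae_of_all _ hpt)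
  rw [integral_const_mul] at this
  calc _ ≤ c⁻¹ * (C * (1 + ‖k‖) ^ (r - 1) * ∫ η, (1 + ‖η‖) ^ (N + 1) * ‖S η‖) := by gcongr
    _ = _ := by ring

theorem integrable_of_isSmoothCompactIn {D : Set (Space d)} {g : Space d → ℂ}
    (hg : IsSmoothCompactIn D g) : Integrable g :=
  hg.1.continuous.integrable_of_hasCompactSupport hg.2.1

theorem integrable_cexp_mul {g : Space d → ℂ} (hg : Integrable g) (ξ : Space d) :
    Integrable fun x => Complex.exp (-(Complex.I * ((inner ℝ x ξ : ℝ) : ℂ))) * g x := by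
  refine hg.norm.mono' (AEStronglyMeasurable.mul ?_ hg.aestronglyMeasurable)
    (ae_of_all _ fun x => ?_)
  · exact Continuous.aestronglyMeasurable (by fun_prop)
  · rw [norm_mul, norm_cexp_neg_I_mul_ofReal, one_mul]

theorem norm_fourierT_le (g : Space d → ℂ) (ξ : Space d) : ‖fourierT g ξ‖ ≤ ∫ x, ‖g x‖ := by
  refine (norm_integral_le_integral_norm _).trans (le_of_eq ?_)
  simp only [norm_mul, norm_cexp_neg_I_mul_ofReal, one_mul]

theorem continuous_fourierT_testFun (φ : TestFun d) : Continuous (fourierT φ) := by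
  obtain ⟨S, hS⟩ := exists_schwartzMap_eq_fourierT φ.contDiff φ.hasCompactSupport
  rw [← funext hS]
  exact S.continuous

theorem stronglyMeasurable_pseudoDiff {r : ℝ} {σ : Space d → Space d → ℂ} (hσ : IsSymbol r σ)
    (φ : TestFun d) : StronglyMeasurable (pseudoDiff σ φ) := by
  refine StronglyMeasurable.const_mul ?_ _
  refine StronglyMeasurable.integral_prod_right'
    (f := fun p : Space d × Space d => Complex.exp (Complex.I * ((inner ℝ p.1 p.2 : ℝ) : ℂ))
      * σ p.1 p.2 * fourierT φ p.2) (Continuous.stronglyMeasurable ?_)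
  refine (Continuous.mul ?_ hσ.1.continuous).mul
    ((continuous_fourierT_testFun φ).comp continuous_snd)
  fun_prop

/-- Asymptotics at high frequency of the form of a pseudo-differential operator with principal
symbol `a(x) |ξ|^{-m}` on two wave packets. -/
theorem norm_integral_pseudoDiff_sub_le {D : Set (Space d)}
    (hDb : Bornology.IsBounded D) {m : ℝ} {a : Space d → ℂ} {σ : Space d → Space d → ℂ}
    (hσ : HasPrincipalSymbol D m a σ) (g h : TestFun d) (hg : ∀ y ∈ D, g y = 1)
    (hh : ∀ y ∈ D, h y = 1) :
    ∃ C, 0 ≤ C ∧ ∀ (k l : Space d) (φ ψ : TestFun d), 1 ≤ ‖k‖ →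
      (∀ y, φ y = g y * Complex.exp (Complex.I * ((inner ℝ k y : ℝ) : ℂ))) →
      (∀ y, ψ y = h y * Complex.exp (-(Complex.I * ((inner ℝ l y : ℝ) : ℂ)))) →
      ‖(∫ y, pseudoDiff σ φ y * ψ y) - ((‖k‖ ^ (-m) : ℝ) : ℂ) * fourierT a (l - k)‖
        ≤ C * ‖k‖ ^ (-m - 1) := by
  obtain ⟨hσs, hσD, ha, b, hb, hbD, hdec⟩ := hσ
  obtain ⟨C, hC, hest⟩ := norm_pseudoDiff_sub_le hσs g
  obtain ⟨Cb, hCb, hbest⟩ := norm_le_of_isSymbol hb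
  have hzero : ∀ {f : Space d → ℂ}, IsSmoothCompactIn D f → ∀ y ∉ D, f y = 0 := fun hf y hy =>
    image_eq_zero_of_notMem_tsupport fun hy' => hy (hf.2.2 hy')
  have hVfin : volume D ≠ ⊤ := hDb.measure_lt_top.ne
  refine ⟨2 ^ |-m - 1| * (C * (∫ y, ‖h y‖) + Cb * volume.real D), ?_,
    fun k l φ ψ hk hφ hψ => ?_⟩
  · have : 0 ≤ ∫ y, ‖h y‖ := integral_nonneg fun _ => norm_nonneg _
    positivity
  set G : Space d → ℂ := fun y => Complex.exp (Complex.I * ((inner ℝ y k : ℝ) : ℂ)) * σ y k * g y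
    with hG
  have hhint : Integrable h := h.continuous.integrable_of_hasCompactSupport h.hasCompactSupport
  have hψint : Integrable ψ := ψ.continuous.integrable_of_hasCompactSupport ψ.hasCompactSupport
  have hσk : Continuous fun y => σ y k := (hσD k).1.continuous
  have hGc : Continuous G := by
    refine (Continuous.mul ?_ hσk).mul g.continuous
    fun_prop
  have hψn : ∀ y, ‖ψ y‖ = ‖h y‖ := fun y => by
    rw [hψ, norm_mul, norm_cexp_neg_I_mul_ofReal, mul_one]
  have hR : Integrable fun y => (pseudoDiff σ φ y - G y) * ψ y :=
    hψint.bdd_mul (c := C * (1 + ‖k‖) ^ (-m - 1))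
      ((stronglyMeasurable_pseudoDiff hσs φ).sub hGc.stronglyMeasurable).aestronglyMeasurable
      (ae_of_all _ fun y => hest k φ hφ y)
  have hGψ : Integrable fun y => G y * ψ y :=
    (hGc.mul ψ.continuous).integrable_of_hasCompactSupport ψ.hasCompactSupport.mul_left
  have hsplit : ∫ y, pseudoDiff σ φ y * ψ y
      = (∫ y, (pseudoDiff σ φ y - G y) * ψ y) + ∫ y, G y * ψ y := by
    rw [← integral_add hR hGψ]
    refine integral_congr_ae (ae_of_all _ fun y => ?_)
    ring
  have hR' : ‖∫ y, (pseudoDiff σ φ y - G y) * ψ y‖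
      ≤ C * (1 + ‖k‖) ^ (-m - 1) * ∫ y, ‖h y‖ := by
    rw [← integral_const_mul]
    refine norm_integral_le_of_norm_le (hhint.norm.const_mul _) (ae_of_all _ fun y => ?_)
    rw [norm_mul, hψn]
    exact mul_le_mul_of_nonneg_right (hest k φ hφ y) (norm_nonneg _)
  have hbint := integrable_of_isSmoothCompactIn (hbD k)
  have haint := integrable_of_isSmoothCompactIn ha
  -- On `D` both cutoffs are 1 and the symbol splits as `a|k|^{-m} + b`; off `D` all three of `σ`,
  -- `a`, `b` vanish.
  have hmain : ∫ y, G y * ψ y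
      = ((‖k‖ ^ (-m) : ℝ) : ℂ) * fourierT a (l - k) + fourierT (fun y => b y k) (l - k) := by
    simp only [fourierT]
    rw [← integral_const_mul, ← integral_add ((integrable_cexp_mul haint _).const_mul _)
      (integrable_cexp_mul hbint _)]
    refine integral_congr_ae (ae_of_all _ fun y => ?_)
    simp only [hG, hψ]
    by_cases hy : y ∈ D
    · rw [hg y hy, hh y hy, hdec y k hk, inner_sub_right, real_inner_comm y l]
      have : Complex.exp (-(Complex.I * ((inner ℝ y l - inner ℝ y k : ℝ) : ℂ)))
          = Complex.exp (Complex.I * ((inner ℝ y k : ℝ) : ℂ))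
            * Complex.exp (-(Complex.I * ((inner ℝ y l : ℝ) : ℂ))) := by
        rw [← Complex.exp_add]; congr 1; push_cast; ring
      rw [this]
      ring
    · rw [hzero (hσD k) y hy, hzero ha y hy, hzero (hbD k) y hy]
      ring
  have hbb : ‖fourierT (fun y => b y k) (l - k)‖ ≤ Cb * (1 + ‖k‖) ^ (-m - 1) * volume.real D := by
    refine (norm_fourierT_le _ _).trans ?_
    have hDint : ∫ y in D, ‖b y k‖ = ∫ y, ‖b y k‖ :=
      setIntegral_eq_integral_of_forall_compl_eq_zero
        fun y hy => by rw [hzero (hbD k) y hy, norm_zero]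
    rw [← hDint]
    have hle := norm_setIntegral_le_of_norm_le_const (f := fun y => ‖b y k‖) (μ := volume)
      (C := Cb * (1 + ‖k‖) ^ (-m - 1)) hVfin.lt_top
      fun y _ => by rw [norm_norm]; exact hbest y k
    exact (le_abs_self _).trans hle
  have hpow : (1 + ‖k‖) ^ (-m - 1) ≤ 2 ^ |-m - 1| * ‖k‖ ^ (-m - 1) :=
    rpow_le_rpow_abs_mul_rpow (by positivity) (by linarith) two_pos (by linarith) (by linarith)
  have h0 : 0 ≤ ∫ y, ‖h y‖ := integral_nonneg fun _ => norm_nonneg _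
  rw [hsplit, hmain, ← add_assoc, add_sub_right_comm, add_sub_cancel_right]
  refine (norm_add_le _ _).trans ((add_le_add hR' hbb).trans ?_)
  calc _ = (C * (∫ y, ‖h y‖) + Cb * volume.real D) * (1 + ‖k‖) ^ (-m - 1) := by ring
    _ ≤ (C * (∫ y, ‖h y‖) + Cb * volume.real D) * (2 ^ |-m - 1| * ‖k‖ ^ (-m - 1)) := by
      gcongr
    _ = _ := by ring

end Symbols

/-! ### The law of large numbers for products of Gaussian pairings. -/

section FieldAverages

variable {d : ℕ} {Ω : Type*} [MeasurableSpace Ω] {P : Measure Ω}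

theorem hasGaussianLaw_re {f : Ω → Distrib d} (hG : ∀ v, HasGaussianLaw (fun ω => f ω v) P)
    (v : TestFun d) : HasGaussianLaw (fun ω => (f ω v).re) P :=
  (hG v).map_fun Complex.reCLM

theorem integrable_mul_apply {f : Ω → Distrib d} (hG : ∀ v, HasGaussianLaw (fun ω => f ω v) P)
    (v w : TestFun d) : Integrable (fun ω => f ω v * f ω w) P :=
  (hG v).memLp_two.integrable_mul (hG w).memLp_two

theorem integrable_conj_mul_apply {f : Ω → Distrib d}
    (hG : ∀ v, HasGaussianLaw (fun ω => f ω v) P) (v w : TestFun d) :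
    Integrable (fun ω => conj (f ω v) * f ω w) P :=
  (((hG v).map_fun (Complex.conjCLE : ℂ →L[ℝ] ℂ)).memLp_two).integrable_mul (hG w).memLp_two

/-- From `Re X · Re Y = Re(XY + X̄Y)/2`. Real parts of rotated pairings form a real Gaussian family,
but their moments mix relation and covariance. -/
theorem integral_re_smul_mul_re_smul {f : Ω → Distrib d}
    (hG : ∀ v, HasGaussianLaw (fun ω => f ω v) P) (α β : ℂ) (v w : TestFun d) :
    ∫ ω, (f ω (α • v)).re * (f ω (β • w)).re ∂P
      = (α * β * (∫ ω, f ω v * f ω w ∂P) + conj α * β * ∫ ω, conj (f ω v) * f ω w ∂P).re / 2 := by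
  have h1 := (integrable_mul_apply hG v w).const_mul (α * β)
  have h2 := (integrable_conj_mul_apply hG v w).const_mul (conj α * β)
  have h3 := ContinuousLinearMap.integral_comp_comm Complex.reCLM (h1.add h2)
  simp only [Pi.add_apply, integral_add h1 h2, integral_const_mul, Complex.reCLM_apply] at h3
  rw [← h3, ← integral_div]
  refine integral_congr_ae (ae_of_all _ fun ω => ?_)
  simp [Complex.add_re, Complex.mul_re, Complex.mul_im]
  ring

/-- A law of large numbers for the product of two members of a centered Gaussian family. -/
theorem ae_tendsto_average_mul [IsProbabilityMeasure P] {V : Type*} [AddCommGroup V]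
    (R : V → Ω → ℝ)
    (hadd : ∀ v w ω, R (v + w) ω = R v ω + R w ω) (hsub : ∀ v w ω, R (v - w) ω = R v ω - R w ω)
    (hG : ∀ v, HasGaussianLaw (R v) P) (h0 : ∀ v, ∫ ω, R v ω ∂P = 0)
    (v₁ v₂ : ℝ → V) (hc₁ : ∀ ω, Continuous fun s => R (v₁ s) ω)
    (hc₂ : ∀ ω, Continuous fun s => R (v₂ s) ω) {m C K c : ℝ} {w : ℝ → ℝ}
    (hw : ContinuousOn w (Ici 1)) (hwm : ∀ s, 1 ≤ s → |w s| ≤ s ^ m)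
    (h11 : ∀ s t, 1 ≤ s → 1 ≤ t → |∫ ω, R (v₁ s) ω * R (v₁ t) ω ∂P|
      ≤ C * s ^ (-m) * ((1 + |s - t|)⁻¹ + s⁻¹))
    (h12 : ∀ s t, 1 ≤ s → 1 ≤ t → |∫ ω, R (v₁ s) ω * R (v₂ t) ω ∂P|
      ≤ C * s ^ (-m) * ((1 + |s - t|)⁻¹ + s⁻¹))
    (h22 : ∀ s t, 1 ≤ s → 1 ≤ t → |∫ ω, R (v₂ s) ω * R (v₂ t) ω ∂P|
      ≤ C * s ^ (-m) * ((1 + |s - t|)⁻¹ + s⁻¹))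
    (hlim : ∀ s, 1 ≤ s → |w s * (∫ ω, R (v₁ s) ω * R (v₂ s) ω ∂P) - c| ≤ K * s⁻¹) :
    ∀ᵐ ω ∂P, Tendsto (fun Q : ℝ => (1 / Q) * ∫ s in Q..(2 * Q), w s * (R (v₁ s) ω * R (v₂ s) ω))
      atTop (𝓝 c) := by
  -- Freezing the time below 1 makes the paths continuous on the whole line, although `w` is
  -- controlled on `[1, ∞)` only; averages with `Q ≥ 1` are unaffected.
  set Z : ℝ → Ω → ℝ := fun s ω =>
    w (max s 1) * (R (v₁ (max s 1)) ω * R (v₂ (max s 1)) ω) - c with hZ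
  have hmax : Continuous fun s : ℝ => max s 1 := continuous_id.max continuous_const
  have hwc : Continuous fun s => w (max s 1) :=
    hw.comp_continuous hmax fun s => mem_Ici.2 (le_max_right _ _)
  have hZc : ∀ ω, Continuous fun s => Z s ω := fun ω =>
    (hwc.mul (((hc₁ ω).comp hmax).mul ((hc₂ ω).comp hmax))).sub continuous_const
  have hZL : ∀ s, MemLp (Z s) 2 P := fun s =>
    ((memLp_two_mul_of_hasGaussianLaw (hG _) (hG _)).const_mul _).sub (memLp_const c)
  have hcomm : ∀ u v : V, ∫ ω, R u ω * R v ω ∂P = ∫ ω, R v ω * R u ω ∂P := fun u v => by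
    simp only [mul_comm]
  have hC0 : 0 ≤ C := by
    have := (abs_nonneg _).trans (h11 1 1 le_rfl le_rfl)
    norm_num at this
    linarith
  have hK0 : 0 ≤ K := by
    have := (abs_nonneg _).trans (hlim 1 le_rfl)
    simpa using this
  have hprod : ∀ s t b b' : ℝ, 1 ≤ s → 1 ≤ t → |b| ≤ C * s ^ (-m) * ((1 + |s - t|)⁻¹ + s⁻¹) →
      |b'| ≤ C * t ^ (-m) * ((1 + |t - s|)⁻¹ + t⁻¹) →
      |w s * w t * (b * b')| ≤ C ^ 2 * (2 * ((1 + (s - t) ^ 2)⁻¹ + (s ^ 2)⁻¹ + (t ^ 2)⁻¹)) := by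
    intro s t b b' hs ht hb hb'
    have hs0 : 0 < s := by linarith
    have ht0 : 0 < t := by linarith
    rw [abs_sub_comm t s] at hb'
    set δ := (1 + |s - t|)⁻¹ with hδ
    have hδ0 : 0 ≤ δ := by positivity
    have hδ2 : δ ^ 2 ≤ (1 + (s - t) ^ 2)⁻¹ := by
      rw [hδ, inv_pow]
      apply inv_anti₀ (by positivity)
      nlinarith [abs_nonneg (s - t), sq_abs (s - t)]
    have e1 : s ^ m * s ^ (-m) = 1 := by rw [← Real.rpow_add hs0, add_neg_cancel, Real.rpow_zero]
    have e2 : t ^ m * t ^ (-m) = 1 := by rw [← Real.rpow_add ht0, add_neg_cancel, Real.rpow_zero]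
    rw [abs_mul, abs_mul, abs_mul]
    have := Real.rpow_nonneg hs0.le m
    have := Real.rpow_nonneg ht0.le m
    calc |w s| * |w t| * (|b| * |b'|)
        ≤ s ^ m * t ^ m * ((C * s ^ (-m) * (δ + s⁻¹)) * (C * t ^ (-m) * (δ + t⁻¹))) := by
          gcongr
          · exact hwm s hs
          · exact hwm t ht
      _ = C ^ 2 * (s ^ m * s ^ (-m)) * (t ^ m * t ^ (-m)) * ((δ + s⁻¹) * (δ + t⁻¹)) := by ring
      _ = C ^ 2 * ((δ + s⁻¹) * (δ + t⁻¹)) := by rw [e1, e2]; ring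
      _ ≤ C ^ 2 * (2 * ((1 + (s - t) ^ 2)⁻¹ + (s ^ 2)⁻¹ + (t ^ 2)⁻¹)) := by
          refine mul_le_mul_of_nonneg_left ?_ (sq_nonneg C)
          rw [← inv_pow, ← inv_pow]
          nlinarith [sq_nonneg (δ - s⁻¹), sq_nonneg (δ - t⁻¹), sq_nonneg (s⁻¹ - t⁻¹),
            sq_nonneg s⁻¹, sq_nonneg t⁻¹]
  have hcov : ∀ s t, 1 ≤ s → 1 ≤ t → |∫ ω, Z s ω * Z t ω ∂P|
      ≤ (4 * C ^ 2 + K ^ 2) * ((1 + (s - t) ^ 2)⁻¹ + (s ^ 2)⁻¹ + (t ^ 2)⁻¹) := by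
    intro s t hs ht
    have hi4 := integrable_mul_mul_mul_of_hasGaussianLaw (hG (v₁ s)) (hG (v₂ s)) (hG (v₁ t))
      (hG (v₂ t))
    have his := integrable_mul_of_hasGaussianLaw (hG (v₁ s)) (hG (v₂ s))
    have hit := integrable_mul_of_hasGaussianLaw (hG (v₁ t)) (hG (v₂ t))
    have hiss := integral_mul_mul_mul_of_hasGaussianLaw R hadd hsub hG h0 (v₁ s) (v₂ s) (v₁ t) (v₂ t)
    -- Of the three Isserlis pairings, the one at equal times combines with `c` into the product of
    -- the two errors in the mean; the other two pair `s` with `t` and decay.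
    have hE : ∫ ω, Z s ω * Z t ω ∂P =
        w s * w t * ((∫ ω, R (v₁ s) ω * R (v₁ t) ω ∂P) * (∫ ω, R (v₂ t) ω * R (v₂ s) ω ∂P))
        + w s * w t * ((∫ ω, R (v₁ s) ω * R (v₂ t) ω ∂P) * (∫ ω, R (v₁ t) ω * R (v₂ s) ω ∂P))
        + (w s * (∫ ω, R (v₁ s) ω * R (v₂ s) ω ∂P) - c)
          * (w t * (∫ ω, R (v₁ t) ω * R (v₂ t) ω ∂P) - c) := by
      have hpt : ∀ ω, Z s ω * Z t ω = w s * w t * (R (v₁ s) ω * R (v₂ s) ω * (R (v₁ t) ω * R (v₂ t) ω))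
          - c * w s * (R (v₁ s) ω * R (v₂ s) ω) - c * w t * (R (v₁ t) ω * R (v₂ t) ω) + c ^ 2 := by
        intro ω
        simp only [hZ, max_eq_left hs, max_eq_left ht]
        ring
      simp_rw [hpt]
      rw [integral_add, integral_sub, integral_sub, integral_const_mul, integral_const_mul,
        integral_const_mul, hiss, hcomm (v₂ t) (v₂ s), hcomm (v₁ t) (v₂ s)]
      · simp
        ring
      · exact hi4.const_mul _
      · exact his.const_mul _
      · exact (hi4.const_mul _).sub (his.const_mul _)
      · exact hit.const_mul _
      · exact ((hi4.const_mul _).sub (his.const_mul _)).sub (hit.const_mul _)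
      · exact integrable_const _
    rw [hE]
    have b1 := hprod s t _ _ hs ht (h11 s t hs ht) (h22 t s ht hs)
    have b2 := hprod s t _ _ hs ht (h12 s t hs ht) (h12 t s ht hs)
    have b3 : |(w s * (∫ ω, R (v₁ s) ω * R (v₂ s) ω ∂P) - c)
          * (w t * (∫ ω, R (v₁ t) ω * R (v₂ t) ω ∂P) - c)|
        ≤ K ^ 2 * ((1 + (s - t) ^ 2)⁻¹ + (s ^ 2)⁻¹ + (t ^ 2)⁻¹) := by
      rw [abs_mul]
      have hs0 : 0 < s := by linarith
      have ht0 : 0 < t := by linarith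
      calc _ ≤ (K * s⁻¹) * (K * t⁻¹) := by
            gcongr
            · exact hlim s hs
            · exact hlim t ht
        _ = K ^ 2 * (s⁻¹ * t⁻¹) := by ring
        _ ≤ _ := by
            refine mul_le_mul_of_nonneg_left ?_ (sq_nonneg K)
            have : 0 ≤ (1 + (s - t) ^ 2)⁻¹ := by positivity
            rw [← inv_pow, ← inv_pow]
            nlinarith [sq_nonneg (s⁻¹ - t⁻¹), sq_nonneg s⁻¹, sq_nonneg t⁻¹]
    refine (abs_add_le _ _).trans ?_
    refine (add_le_add_left (abs_add_le _ _) _).trans ?_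
    linarith
  filter_upwards [ae_tendsto_average_zero Z hZc hZL hcov] with ω hω
  have hω' := hω.add_const c
  rw [zero_add] at hω'
  refine hω'.congr' ?_
  filter_upwards [eventually_ge_atTop 1] with Q hQ
  have hle : Q ≤ 2 * Q := by linarith
  have hcongr : ∫ s in Q..(2 * Q), w s * (R (v₁ s) ω * R (v₂ s) ω)
      = ∫ s in Q..(2 * Q), (Z s ω + c) := by
    refine intervalIntegral.integral_congr fun s hs => ?_
    rw [uIcc_of_le hle] at hs
    have h1 : 1 ≤ s := hQ.trans hs.1
    simp only [hZ, max_eq_left h1, sub_add_cancel]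
  rw [hcongr, intervalIntegral.integral_add ((hZc ω).intervalIntegrable _ _)
    intervalIntegrable_const, intervalIntegral.integral_const]
  simp only [smul_eq_mul]
  field_simp
  ring

/-- A law of large numbers for the products of the values of a Gaussian random distribution on two
families of test functions. -/
theorem ae_tendsto_average_apply_mul_apply [IsProbabilityMeasure P] {f : Ω → Distrib d}
    (hG : ∀ v, HasGaussianLaw (fun ω => f ω v) P) (h0 : ∀ v, ∫ ω, f ω v ∂P = 0)
    (v : Fin 2 → ℝ → TestFun d) (hv : ∀ i, Continuous (v i)) {m C K : ℝ} {a₁ a₂ : ℂ} {w : ℝ → ℝ}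
    (hw : ContinuousOn w (Ici 1)) (hwm : ∀ s, 1 ≤ s → |w s| ≤ s ^ m)
    (hrel : ∀ i j s t, 1 ≤ s → 1 ≤ t → ‖∫ ω, f ω (v i s) * f ω (v j t) ∂P‖
      ≤ C * s ^ (-m) * ((1 + |s - t|)⁻¹ + s⁻¹))
    (hcov : ∀ i j s t, 1 ≤ s → 1 ≤ t → ‖∫ ω, conj (f ω (v i s)) * f ω (v j t) ∂P‖
      ≤ C * s ^ (-m) * ((1 + |s - t|)⁻¹ + s⁻¹))
    (hrel' : ∀ s, 1 ≤ s → ‖(w s : ℂ) * (∫ ω, f ω (v 0 s) * f ω (v 1 s) ∂P) - a₁‖ ≤ K * s⁻¹)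
    (hcov' : ∀ s, 1 ≤ s → ‖(w s : ℂ) * (∫ ω, conj (f ω (v 0 s)) * f ω (v 1 s) ∂P) - a₂‖ ≤ K * s⁻¹) :
    ∀ᵐ ω ∂P,
      Tendsto (fun Q : ℝ => ((1 / Q : ℝ) : ℂ) *
        ∫ s in Q..(2 * Q), (w s : ℂ) * (f ω (v 0 s) * f ω (v 1 s))) atTop (𝓝 a₁) ∧
      Tendsto (fun Q : ℝ => ((1 / Q : ℝ) : ℂ) *
        ∫ s in Q..(2 * Q), (w s : ℂ) * (conj (f ω (v 0 s)) * f ω (v 1 s))) atTop (𝓝 a₂) := by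
  -- Since `Re(-iz) = Im z`, the phases 1 and `-i` yield the four products of real and imaginary
  -- parts, from which both complex products are recombined.
  have hphase : ∀ α β : ℂ, ‖α‖ = 1 → ‖β‖ = 1 → ∀ᵐ ω ∂P, Tendsto (fun Q : ℝ => (1 / Q) *
      ∫ s in Q..(2 * Q), w s * ((f ω (α • v 0 s)).re * (f ω (β • v 1 s)).re))
      atTop (𝓝 ((α * β * a₁ + conj α * β * a₂).re / 2)) := by
    intro α β hα hβ
    have hbound : ∀ α β : ℂ, ‖α‖ = 1 → ‖β‖ = 1 → ∀ i j s t, 1 ≤ s → 1 ≤ t →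
        |∫ ω, (f ω (α • v i s)).re * (f ω (β • v j t)).re ∂P|
          ≤ C * s ^ (-m) * ((1 + |s - t|)⁻¹ + s⁻¹) := by
      intro α β hα hβ i j s t hs ht
      rw [integral_re_smul_mul_re_smul hG, abs_div, abs_two, div_le_iff₀ two_pos]
      refine (Complex.abs_re_le_norm _).trans ((norm_add_le _ _).trans ?_)
      simp only [norm_mul, RCLike.norm_conj, hα, hβ, one_mul]
      linarith [hrel i j s t hs ht, hcov i j s t hs ht]
    refine ae_tendsto_average_mul (fun v ω => (f ω v).re) (fun v w ω => by simp)
      (fun v w ω => by simp) (hasGaussianLaw_re hG) (fun v => ?_) (fun s => α • v 0 s)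
      (fun s => β • v 1 s) (fun ω => ?_) (fun ω => ?_) (K := K) hw hwm (hbound α α hα hα 0 0)
      (hbound α β hα hβ 0 1) (hbound β β hβ hβ 1 1) (fun s hs => ?_)
    · have := ContinuousLinearMap.integral_comp_comm Complex.reCLM (hG v).integrable
      rw [h0] at this
      simpa using this
    · simp only [map_smul]
      exact Complex.continuous_re.comp (((f ω).continuous.comp (hv 0)).const_smul α)
    · simp only [map_smul]
      exact Complex.continuous_re.comp (((f ω).continuous.comp (hv 1)).const_smul β)
    · rw [integral_re_smul_mul_re_smul hG]
      set r := ∫ ω, f ω (v 0 s) * f ω (v 1 s) ∂P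
      set q := ∫ ω, conj (f ω (v 0 s)) * f ω (v 1 s) ∂P
      have e : w s * ((α * β * r + conj α * β * q).re / 2) - (α * β * a₁ + conj α * β * a₂).re / 2
          = (α * β * ((w s : ℂ) * r - a₁) + conj α * β * ((w s : ℂ) * q - a₂)).re / 2 := by
        simp [Complex.add_re, Complex.mul_re, Complex.mul_im]
        ring
      rw [e, abs_div, abs_two, div_le_iff₀ two_pos]
      refine (Complex.abs_re_le_norm _).trans ((norm_add_le _ _).trans ?_)
      simp only [norm_mul, RCLike.norm_conj, hα, hβ, one_mul]
      linarith [hrel' s hs, hcov' s hs]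
  have hI : ‖-Complex.I‖ = 1 := by simp
  have h1 : ‖(1 : ℂ)‖ = 1 := norm_one
  filter_upwards [hphase 1 1 h1 h1, hphase 1 (-Complex.I) h1 hI, hphase (-Complex.I) 1 hI h1,
    hphase (-Complex.I) (-Complex.I) hI hI] with ω t11 t1I tI1 tII
  set F : ℂ → ℂ → ℝ → ℝ := fun α β s => w s * ((f ω (α • v 0 s)).re * (f ω (β • v 1 s)).re) with hF
  have hint : ∀ (α β : ℂ) (Q : ℝ), 1 ≤ Q →
      IntervalIntegrable (fun s => ((F α β s : ℝ) : ℂ)) volume Q (2 * Q) := by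
    intro α β Q hQ
    refine ContinuousOn.intervalIntegrable ?_
    rw [uIcc_of_le (by linarith)]
    refine Complex.continuous_ofReal.comp_continuousOn
      ((hw.mono fun s hs => hQ.trans hs.1).mul (Continuous.continuousOn ?_))
    simp only [map_smul]
    exact (Complex.continuous_re.comp (((f ω).continuous.comp (hv 0)).const_smul α)).mul
      (Complex.continuous_re.comp (((f ω).continuous.comp (hv 1)).const_smul β))
  have hofReal : ∀ {g : ℝ → ℝ} {c : ℝ}, Tendsto g atTop (𝓝 c) →
      Tendsto (fun Q => (g Q : ℂ)) atTop (𝓝 (c : ℂ)) := fun hg =>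
    (Complex.continuous_ofReal.tendsto _).comp hg
  constructor
  · have := ((hofReal t11).sub (hofReal tII)).add
      (((hofReal t1I).add (hofReal tI1)).const_mul Complex.I)
    convert! this.congr' ?_ using 2
    · apply Complex.ext <;> simp <;> ring
    · filter_upwards [eventually_ge_atTop 1] with Q hQ
      have e : ∫ s in Q..(2 * Q), (w s : ℂ) * (f ω (v 0 s) * f ω (v 1 s))
          = ∫ s in Q..(2 * Q), (((F 1 1 s : ℝ) : ℂ) - ((F (-Complex.I) (-Complex.I) s : ℝ) : ℂ)
            + Complex.I * (((F 1 (-Complex.I) s : ℝ) : ℂ) + ((F (-Complex.I) 1 s : ℝ) : ℂ))) := by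
        refine intervalIntegral.integral_congr fun s _ => ?_
        simp only [hF, map_smul]
        apply Complex.ext <;> simp <;> ring
      rw [e, intervalIntegral.integral_add ((hint _ _ Q hQ).sub (hint _ _ Q hQ))
          (((hint _ _ Q hQ).add (hint _ _ Q hQ)).const_mul _),
        intervalIntegral.integral_sub (hint _ _ Q hQ) (hint _ _ Q hQ),
        intervalIntegral.integral_const_mul,
        intervalIntegral.integral_add (hint _ _ Q hQ) (hint _ _ Q hQ)]
      simp only [intervalIntegral.integral_ofReal, Complex.ofReal_mul]
      ring
  · have := ((hofReal t11).add (hofReal tII)).add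
      (((hofReal t1I).sub (hofReal tI1)).const_mul Complex.I)
    convert! this.congr' ?_ using 2
    · apply Complex.ext <;> simp <;> ring
    · filter_upwards [eventually_ge_atTop 1] with Q hQ
      have e : ∫ s in Q..(2 * Q), (w s : ℂ) * (conj (f ω (v 0 s)) * f ω (v 1 s))
          = ∫ s in Q..(2 * Q), (((F 1 1 s : ℝ) : ℂ) + ((F (-Complex.I) (-Complex.I) s : ℝ) : ℂ)
            + Complex.I * (((F 1 (-Complex.I) s : ℝ) : ℂ) - ((F (-Complex.I) 1 s : ℝ) : ℂ))) := by
        refine intervalIntegral.integral_congr fun s _ => ?_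
        simp only [hF, map_smul]
        apply Complex.ext <;> simp <;> ring
      rw [e, intervalIntegral.integral_add ((hint _ _ Q hQ).add (hint _ _ Q hQ))
          (((hint _ _ Q hQ).sub (hint _ _ Q hQ)).const_mul _),
        intervalIntegral.integral_add (hint _ _ Q hQ) (hint _ _ Q hQ),
        intervalIntegral.integral_const_mul,
        intervalIntegral.integral_sub (hint _ _ Q hQ) (hint _ _ Q hQ)]
      simp only [intervalIntegral.integral_ofReal, Complex.ofReal_mul]
      ring

end FieldAverages

/-! ### Moments and almost sure limits of the far field. -/

section FarField

variable {d : ℕ} {Ω : Type*} [MeasurableSpace Ω] {P : Measure Ω}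

theorem conjTest_apply (φ : TestFun d) (y : Space d) : conjTest φ y = conj (φ y) := rfl

theorem conjTest_conjTest (φ : TestFun d) : conjTest (conjTest φ) = φ := by
  ext y; simp [conjTest_apply]

/-- First-order decay suffices: correlations of products are quadratic in the second moments, so the
rate becomes integrable. -/
theorem norm_fourierT_le_inv {D : Set (Space d)} {g : Space d → ℂ} (hg : IsSmoothCompactIn D g) :
    ∃ A, 0 ≤ A ∧ ∀ ξ, ‖fourierT g ξ‖ ≤ A * (1 + ‖ξ‖)⁻¹ := by
  obtain ⟨S, hS⟩ := exists_schwartzMap_eq_fourierT hg.1 hg.2.1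
  obtain ⟨C₀, hC₀, h₀⟩ := S.decay 0 0
  obtain ⟨C₁, hC₁, h₁⟩ := S.decay 1 0
  refine ⟨C₀ + C₁, by positivity, fun ξ => ?_⟩
  have e₀ := h₀ ξ
  have e₁ := h₁ ξ
  simp only [pow_zero, one_mul, pow_one, norm_iteratedFDeriv_zero] at e₀ e₁
  rw [← hS, ← div_eq_mul_inv, le_div_iff₀ (by positivity)]
  linarith

/-- Second moments of a GMIG field tested against cut-off plane waves. -/
theorem norm_integral_cutPlaneWave_sub_le {D : Set (Space d)} (hDb : Bornology.IsBounded D) {m : ℝ}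
    {f : Ω → Distrib d} {ac ar : Space d → ℂ} (hf : IsCenteredGMIG P f D m ac ar)
    {χ : TestFun d} (hχ : ∀ y ∈ D, χ y = 1) :
    ∃ C, 0 ≤ C ∧ ∀ x x' : Space d, ‖x‖ = 1 → ∀ κ κ' : ℝ, 1 ≤ κ →
      ‖(∫ ω, f ω (cutPlaneWave χ x κ) * f ω (cutPlaneWave χ x' κ') ∂P)
        - ((κ ^ (-m) : ℝ) : ℂ) * fourierT ar (κ • x + κ' • x')‖ ≤ C * κ ^ (-m - 1) ∧
      ‖(∫ ω, conj (f ω (cutPlaneWave χ x κ)) * f ω (cutPlaneWave χ x' κ') ∂P)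
        - ((κ ^ (-m) : ℝ) : ℂ) * fourierT ac (κ' • x' - κ • x)‖ ≤ C * κ ^ (-m - 1) := by
  obtain ⟨σc, hσc, hc⟩ := hf.cov
  obtain ⟨σr, hσr, hr⟩ := hf.rel
  obtain ⟨C₁, hC₁, h₁⟩ := norm_integral_pseudoDiff_sub_le hDb hσc (conjTest χ) χ
    (fun y hy => by simp [conjTest_apply, hχ y hy]) hχ
  obtain ⟨C₂, hC₂, h₂⟩ := norm_integral_pseudoDiff_sub_le hDb hσr χ χ hχ hχ
  refine ⟨C₁ + C₂, by positivity, fun x x' hx κ κ' hκ => ⟨?_, ?_⟩⟩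
  · have hnorm : ‖-(κ • x)‖ = κ := by
      rw [norm_neg, norm_smul, hx, mul_one, Real.norm_of_nonneg (by linarith)]
    -- The plane wave `e^{-iκx·y}` is a packet of frequency `-κx`, whence the sum of frequencies in
    -- the relation. In the covariance the first argument is conjugated, its frequency is `κx`, and
    -- the difference appears.
    have := h₂ (-(κ • x)) (κ' • x') (cutPlaneWave χ x κ) (cutPlaneWave χ x' κ')
      (by rw [hnorm]; exact hκ)
      (fun y => by
        rw [cutPlaneWave_apply, inner_neg_left, real_inner_smul_left]; congr 2; push_cast; ring)
      (fun y => by rw [cutPlaneWave_apply, real_inner_smul_left])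
    rw [← hr, hnorm, sub_neg_eq_add, add_comm (κ' • x')] at this
    simp only [relForm, hf.centered, sub_zero] at this
    refine this.trans ?_
    have := Real.rpow_nonneg (by linarith : 0 ≤ κ) (-m - 1)
    nlinarith
  · have hnorm : ‖κ • x‖ = κ := by
      rw [norm_smul, hx, mul_one, Real.norm_of_nonneg (by linarith)]
    have := h₁ (κ • x) (κ' • x') (conjTest (cutPlaneWave χ x κ)) (cutPlaneWave χ x' κ')
      (by rw [hnorm]; exact hκ)
      (fun y => by
        rw [conjTest_apply, conjTest_apply, cutPlaneWave_apply, real_inner_smul_left, map_mul,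
          ← Complex.exp_conj]
        simp)
      (fun y => by rw [cutPlaneWave_apply, real_inner_smul_left])
    rw [← hc, hnorm] at this
    simp only [covForm, hf.centered, sub_zero, conjTest_conjTest] at this
    refine this.trans ?_
    have := Real.rpow_nonneg (by linarith : 0 ≤ κ) (-m - 1)
    nlinarith

/-- With `e = (d-3)/2`, this is the averaging weight times the two far-field amplitudes. It equals
`s^m ((s+τ)/s)^e`, and `-1 ≤ e ≤ 0` places the last factor between `s/(s+τ)` and 1. -/
theorem rpow_weight_bounds {m e τ s : ℝ} (he : e ≤ 0) (he' : -1 ≤ e) (hτ : 0 ≤ τ) (hs : 1 ≤ s) :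
    |s ^ (m - 2 * e) * (s + τ) ^ e * s ^ e| ≤ s ^ m ∧
      |s ^ (m - 2 * e) * (s + τ) ^ e * s ^ e * s ^ (-m) - 1| ≤ τ * s⁻¹ := by
  have hs0 : 0 < s := by linarith
  have h1 : s ^ (m - 2 * e) * s ^ e = s ^ m * s ^ (-e) := by
    rw [← Real.rpow_add hs0, ← Real.rpow_add hs0]; ring_nf
  have h2 : s ^ (m - 2 * e) * (s + τ) ^ e * s ^ e = s ^ m * ((s + τ) / s) ^ e := by
    rw [Real.div_rpow (by positivity) hs0.le, div_eq_mul_inv, ← Real.rpow_neg hs0.le,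
      mul_right_comm, h1]
    ring
  have h3 : 1 ≤ (s + τ) / s := by rw [le_div_iff₀ hs0]; linarith
  have h4 : ((s + τ) / s) ^ e ≤ 1 := Real.rpow_le_one_of_one_le_of_nonpos h3 he
  have h5 : 0 ≤ ((s + τ) / s) ^ e := by positivity
  have h6 : s / (s + τ) ≤ ((s + τ) / s) ^ e := by
    have := Real.rpow_le_rpow_of_exponent_le h3 he'
    rwa [Real.rpow_neg_one, inv_div] at this
  have h7 : s ^ m * s ^ (-m) = 1 := by rw [← Real.rpow_add hs0]; simp
  have hm := Real.rpow_nonneg hs0.le m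
  rw [h2]
  constructor
  · rw [abs_of_nonneg (by positivity)]
    exact mul_le_of_le_one_right hm h4
  · rw [mul_right_comm, h7, one_mul, abs_sub_comm, abs_of_nonneg (by linarith)]
    have : 1 - s / (s + τ) ≤ τ * s⁻¹ := by
      rw [one_sub_div (by positivity), add_sub_cancel_left, div_eq_mul_inv]
      gcongr
      linarith
    linarith

/-- Almost sure limits of the band averages of the products of two plane wave coefficients of a
GMIG field. -/
theorem ae_tendsto_average_cutPlaneWave [IsProbabilityMeasure P] {D : Set (Space d)}
    (hDb : Bornology.IsBounded D) {m : ℝ}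
    {f : Ω → Distrib d} {ac ar : Space d → ℂ} (hf : IsCenteredGMIG P f D m ac ar)
    {χ : TestFun d} (hχ : ∀ y ∈ D, χ y = 1) {x x' : Space d} (hx : ‖x‖ = 1) (hx' : ‖x'‖ = 1)
    {e τ B : ℝ} (he : e ≤ 0) (he' : -1 ≤ e) (hτ : 0 ≤ τ) {a₁ a₂ : ℂ}
    (h₁ : ∀ s : ℝ, 1 ≤ s → ‖fourierT ar (s • x' + (s + τ) • x) - a₁‖ ≤ B * s⁻¹)
    (h₂ : ∀ s : ℝ, 1 ≤ s → ‖fourierT ac ((s + τ) • x - s • x') - a₂‖ ≤ B * s⁻¹) :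
    ∀ᵐ ω ∂P,
      Tendsto (fun Q : ℝ => ((1 / Q : ℝ) : ℂ) * ∫ s in Q..(2 * Q),
        ((s ^ (m - 2 * e) * (s + τ) ^ e * s ^ e : ℝ) : ℂ) *
          (f ω (cutPlaneWave χ x' s) * f ω (cutPlaneWave χ x (s + τ)))) atTop (𝓝 a₁) ∧
      Tendsto (fun Q : ℝ => ((1 / Q : ℝ) : ℂ) * ∫ s in Q..(2 * Q),
        ((s ^ (m - 2 * e) * (s + τ) ^ e * s ^ e : ℝ) : ℂ) *
          (conj (f ω (cutPlaneWave χ x' s)) * f ω (cutPlaneWave χ x (s + τ)))) atTop (𝓝 a₂) := by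
  obtain ⟨C, hC, hest⟩ := norm_integral_cutPlaneWave_sub_le hDb hf hχ
  obtain ⟨σc, hσc, -⟩ := hf.cov
  obtain ⟨σr, hσr, -⟩ := hf.rel
  obtain ⟨Ac, hAc, hac⟩ := norm_fourierT_le_inv hσc.2.2.1
  obtain ⟨Ar, hAr, har⟩ := norm_fourierT_le_inv hσr.2.2.1
  set w : ℝ → ℝ := fun s => s ^ (m - 2 * e) * (s + τ) ^ e * s ^ e with hw
  have hwc : ContinuousOn w (Ici 1) := by
    refine ((continuousOn_id.rpow_const ?_).mul
      ((continuousOn_id.add continuousOn_const).rpow_const ?_)).mul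
      (continuousOn_id.rpow_const ?_) <;>
    · intro s hs
      left
      have : (1 : ℝ) ≤ s := hs
      first
      | exact (by linarith : (0 : ℝ) < s).ne'
      | exact (by linarith : (0 : ℝ) < s + τ).ne'
  set dir : Fin 2 → Space d := ![x', x] with hdir
  set sh : Fin 2 → ℝ := ![0, τ] with hsh
  have hdir1 : ∀ i, ‖dir i‖ = 1 := by
    intro i; fin_cases i
    · exact hx'
    · exact hx
  have hsh0 : ∀ i, 0 ≤ sh i ∧ sh i ≤ τ := by
    intro i; fin_cases i
    · exact ⟨le_rfl, hτ⟩
    · exact ⟨hτ, le_rfl⟩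
  have hpw : ∀ κ : ℝ, 1 ≤ κ → κ ^ (-m - 1) = κ ^ (-m) * κ⁻¹ := fun κ hκ => by
    rw [Real.rpow_sub_one (by linarith), div_eq_mul_inv]
  have hbd : ∀ (z F : ℂ) (A κ κ' : ℝ) (ξ : Space d), 0 ≤ A → 1 ≤ κ →
      ‖z - ((κ ^ (-m) : ℝ) : ℂ) * F‖ ≤ C * κ ^ (-m - 1) → ‖F‖ ≤ A * (1 + ‖ξ‖)⁻¹ → |κ - κ'| ≤ ‖ξ‖ →
      ‖z‖ ≤ (C + A) * κ ^ (-m) * ((1 + |κ - κ'|)⁻¹ + κ⁻¹) := by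
    intro z F A κ κ' ξ hA hκ hz hF hξ
    have hk : 0 ≤ κ ^ (-m) := Real.rpow_nonneg (by linarith) _
    have hF' : ‖F‖ ≤ A * (1 + |κ - κ'|)⁻¹ := hF.trans (by gcongr)
    have h3 : ‖((κ ^ (-m) : ℝ) : ℂ) * F‖ ≤ κ ^ (-m) * (A * (1 + |κ - κ'|)⁻¹) := by
      rw [norm_mul, Complex.norm_real, Real.norm_of_nonneg hk]
      gcongr
    have h4 := norm_le_norm_sub_add z (((κ ^ (-m) : ℝ) : ℂ) * F)
    rw [hpw κ hκ] at hz
    have h5 : 0 ≤ κ ^ (-m) * (1 + |κ - κ'|)⁻¹ := by positivity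
    have h6 : 0 ≤ κ ^ (-m) * κ⁻¹ := mul_nonneg hk (inv_nonneg.2 (by linarith))
    nlinarith [mul_nonneg hC h5, mul_nonneg hA h6]
  -- The two families run at frequencies `s` and `s + τ`; shifts of size at most `τ` change the
  -- decay bound only by a factor depending on `τ` and `m`.
  have hshift : ∀ (K : ℝ) (i j : Fin 2) (s t : ℝ), 0 ≤ K → 1 ≤ s → 1 ≤ t →
      K * (s + sh i) ^ (-m) * ((1 + |s + sh i - (t + sh j)|)⁻¹ + (s + sh i)⁻¹)
        ≤ K * (1 + τ) ^ |-m| * (1 + τ) * s ^ (-m) * ((1 + |s - t|)⁻¹ + s⁻¹) := by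
    intro K i j s t hK hs ht
    obtain ⟨hi0, hi1⟩ := hsh0 i
    obtain ⟨hj0, hj1⟩ := hsh0 j
    have hs0 : 0 < s := by linarith
    have k1 : (s + sh i) ^ (-m) ≤ (1 + τ) ^ |-m| * s ^ (-m) := by
      refine rpow_le_rpow_abs_mul_rpow (by linarith) hs0 (by linarith) ?_ ?_ <;> nlinarith
    have k2 : (1 + |s + sh i - (t + sh j)|)⁻¹ ≤ (1 + τ) * (1 + |s - t|)⁻¹ := by
      rw [← div_eq_mul_inv, inv_eq_one_div, div_le_div_iff₀ (by positivity) (by positivity)]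
      have : |s - t| ≤ |s + sh i - (t + sh j)| + τ := by
        have h7 : |sh i - sh j| ≤ τ := abs_le.2 ⟨by linarith, by linarith⟩
        calc |s - t| = |(s + sh i - (t + sh j)) - (sh i - sh j)| := by congr 1; ring
          _ ≤ |s + sh i - (t + sh j)| + |sh i - sh j| := abs_sub _ _
          _ ≤ _ := by gcongr
      nlinarith [abs_nonneg (s + sh i - (t + sh j))]
    have k3 : (s + sh i)⁻¹ ≤ (1 + τ) * s⁻¹ := by
      have h8 : (s + sh i)⁻¹ ≤ s⁻¹ := inv_anti₀ hs0 (by linarith)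
      have h9 : 0 ≤ s⁻¹ := by positivity
      nlinarith
    calc _ ≤ K * ((1 + τ) ^ |-m| * s ^ (-m)) * ((1 + τ) * (1 + |s - t|)⁻¹ + (1 + τ) * s⁻¹) := by
          gcongr
      _ = _ := by ring
  -- The reverse triangle inequality gives decay in `|κ - κ'|` for every pair of unit directions,
  -- with either sign.
  have hlow : ∀ (i j : Fin 2) (κ κ' : ℝ), 0 ≤ κ → 0 ≤ κ' →
      |κ - κ'| ≤ ‖κ • dir i + κ' • dir j‖ ∧ |κ - κ'| ≤ ‖κ' • dir j - κ • dir i‖ := by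
    intro i j κ κ' hκ hκ'
    have n1 : ‖κ • dir i‖ = κ := by rw [norm_smul, hdir1, mul_one, Real.norm_of_nonneg hκ]
    have n2 : ‖κ' • dir j‖ = κ' := by rw [norm_smul, hdir1, mul_one, Real.norm_of_nonneg hκ']
    constructor
    · have := abs_norm_sub_norm_le (κ • dir i) (-(κ' • dir j))
      rwa [norm_neg, n1, n2, sub_neg_eq_add] at this
    · have := abs_norm_sub_norm_le (κ' • dir j) (κ • dir i)
      rwa [n1, n2, abs_sub_comm] at this
  -- Three errors of order `s⁻¹`: freezing the symbol (`C`), the weight (`τ * A`), and the distance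
  -- of the Fourier value from its limit (`B`).
  have hlim : ∀ (z F b : ℂ) (A s : ℝ) (ξ : Space d), 0 ≤ A → 1 ≤ s →
      ‖z - ((s ^ (-m) : ℝ) : ℂ) * F‖ ≤ C * s ^ (-m - 1) → ‖F‖ ≤ A * (1 + ‖ξ‖)⁻¹ →
      ‖F - b‖ ≤ B * s⁻¹ → ‖(w s : ℂ) * z - b‖ ≤ (C + τ * A + B) * s⁻¹ := by
    intro z F b A s ξ hA hs hz hF hb
    obtain ⟨w1, w2⟩ := rpow_weight_bounds (m := m) he he' hτ hs
    have hs0 : 0 < s := by linarith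
    have hF' : ‖F‖ ≤ A := hF.trans (mul_le_of_le_one_right hA
      (inv_le_one_of_one_le₀ (by linarith [norm_nonneg ξ])))
    have heq : (w s : ℂ) * z - b = (w s : ℂ) * (z - ((s ^ (-m) : ℝ) : ℂ) * F)
        + ((w s * s ^ (-m) - 1 : ℝ) : ℂ) * F + (F - b) := by push_cast; ring
    have t1 : ‖(w s : ℂ) * (z - ((s ^ (-m) : ℝ) : ℂ) * F)‖ ≤ C * s⁻¹ := by
      rw [norm_mul, Complex.norm_real, Real.norm_eq_abs]
      have hm := Real.rpow_nonneg hs0.le m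
      calc _ ≤ s ^ m * (C * s ^ (-m - 1)) := by gcongr
        _ = C * (s ^ m * s ^ (-m)) * s⁻¹ := by rw [hpw s hs]; ring
        _ = C * s⁻¹ := by rw [← Real.rpow_add hs0]; simp
    have t2 : ‖((w s * s ^ (-m) - 1 : ℝ) : ℂ) * F‖ ≤ τ * A * s⁻¹ := by
      rw [norm_mul, Complex.norm_real, Real.norm_eq_abs]
      calc _ ≤ (τ * s⁻¹) * A := by gcongr
        _ = _ := by ring
    rw [heq]
    refine (norm_add_le _ _).trans ((add_le_add ((norm_add_le _ _).trans (add_le_add t1 t2))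
      hb).trans (le_of_eq (by ring)))
  set A := max Ac Ar with hA
  have hA0 : 0 ≤ A := hAc.trans (le_max_left _ _)
  have hac' : ∀ ξ, ‖fourierT ac ξ‖ ≤ A * (1 + ‖ξ‖)⁻¹ := fun ξ =>
    (hac ξ).trans (by gcongr; exact le_max_left _ _)
  have har' : ∀ ξ, ‖fourierT ar ξ‖ ≤ A * (1 + ‖ξ‖)⁻¹ := fun ξ =>
    (har ξ).trans (by gcongr; exact le_max_right _ _)
  have key := ae_tendsto_average_apply_mul_apply (P := P) (f := f) hf.gaussian hf.centered
    (fun i s => cutPlaneWave χ (dir i) (s + sh i))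
    (fun i => (continuous_cutPlaneWave χ (dir i)).comp (continuous_id.add continuous_const))
    (m := m) (C := (C + A) * (1 + τ) ^ |-m| * (1 + τ)) (K := C + τ * A + B) (a₁ := a₁) (a₂ := a₂)
    hwc (fun s hs => (rpow_weight_bounds (m := m) he he' hτ hs).1)
    (fun i j s t hs ht => by
      have hi := (hsh0 i).1
      have hj := (hsh0 j).1
      exact (hbd _ _ A _ _ _ hA0 (by linarith)
        (hest (dir i) (dir j) (hdir1 i) (s + sh i) (t + sh j) (by linarith)).1 (har' _)
        (hlow i j _ _ (by linarith) (by linarith)).1).trans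
        (hshift _ i j s t (by positivity) hs ht))
    (fun i j s t hs ht => by
      have hi := (hsh0 i).1
      have hj := (hsh0 j).1
      exact (hbd _ _ A _ _ _ hA0 (by linarith)
        (hest (dir i) (dir j) (hdir1 i) (s + sh i) (t + sh j) (by linarith)).2 (hac' _)
        (hlow i j _ _ (by linarith) (by linarith)).2).trans
        (hshift _ i j s t (by positivity) hs ht))
    (fun s hs => by
      simp only [hdir, hsh, Matrix.cons_val_zero, Matrix.cons_val_one, add_zero]
      exact hlim _ _ _ A s _ hA0 hs (hest x' x hx' s (s + τ) hs).1 (har' _) (h₁ s hs))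
    (fun s hs => by
      simp only [hdir, hsh, Matrix.cons_val_zero, Matrix.cons_val_one, add_zero]
      exact hlim _ _ _ A s _ hA0 hs (hest x' x hx' s (s + τ) hs).2 (hac' _) (h₂ s hs))
  simpa only [hdir, hsh, Matrix.cons_val_zero, Matrix.cons_val_one, add_zero] using key

theorem norm_fourierT_le_of_le_norm {D : Set (Space d)} {g : Space d → ℂ}
    (hg : IsSmoothCompactIn D g) :
    ∃ B, 0 ≤ B ∧ ∀ (s : ℝ) (ξ : Space d), 1 ≤ s → s ≤ ‖ξ‖ → ‖fourierT g ξ‖ ≤ B * s⁻¹ := by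
  obtain ⟨A, hA, h⟩ := norm_fourierT_le_inv hg
  refine ⟨A, hA, fun s ξ hs hξ => (h ξ).trans ?_⟩
  gcongr
  linarith

/-- The almost sure limits of the frequency averages of the far-field pattern. -/
theorem ae_tendsto_avgCov_avgRel (hd : d = 2 ∨ d = 3) [IsProbabilityMeasure P] {D : Set (Space d)}
    (hDb : Bornology.IsBounded D) {m : ℝ}
    {f : Ω → Distrib d} {ac ar : Space d → ℂ} (hf : IsCenteredGMIG P f D m ac ar)
    {χ : TestFun d} (hχ : ∀ y ∈ D, χ y = 1) {x : Space d} (hx : ‖x‖ = 1) {τ : ℝ} (hτ : 0 ≤ τ) :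
    ∀ᵐ ω ∂P,
      Tendsto (fun Q : ℝ => avgCov m (farField χ (f ω)) τ x Q) atTop
        (𝓝 (((‖farConst d‖ ^ 2 : ℝ) : ℂ) * fourierT ac (τ • x))) ∧
      Tendsto (fun Q : ℝ => avgRel m (farField χ (f ω)) τ x Q) atTop
        (𝓝 (farConst d ^ 2 * fourierT ar (τ • x))) := by
  obtain ⟨σc, hσc, -⟩ := hf.cov
  obtain ⟨σr, hσr, -⟩ := hf.rel
  obtain ⟨Bc, hBc, hac⟩ := norm_fourierT_le_of_le_norm hσc.2.2.1
  obtain ⟨Br, hBr, har⟩ := norm_fourierT_le_of_le_norm hσr.2.2.1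
  set e : ℝ := ((d : ℝ) - 3) / 2 with he_def
  have he : e ≤ 0 := by rcases hd with rfl | rfl <;> norm_num [he_def]
  have he' : -1 ≤ e := by rcases hd with rfl | rfl <;> norm_num [he_def]
  have hexp : m + 3 - (d : ℝ) = m - 2 * e := by rw [he_def]; ring
  -- In each of the two averages the moment of the other type has its frequency escaping to
  -- infinity, so its limit is 0.
  have hfar : ∀ s : ℝ, 1 ≤ s → s ≤ ‖s • x + (s + τ) • x‖ := fun s hs => by
    rw [← add_smul, norm_smul, hx, mul_one, Real.norm_of_nonneg (by linarith)]
    linarith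
  have hnear : ∀ s : ℝ, (s + τ) • x - s • x = τ • x := fun s => by
    rw [← sub_smul, add_sub_cancel_left]
  have hcov := ae_tendsto_average_cutPlaneWave hDb hf hχ hx hx he he' hτ (B := Br) (a₁ := 0)
    (a₂ := fourierT ac (τ • x))
    (fun s hs => by rw [sub_zero]; exact har s _ hs (hfar s hs))
    (fun s hs => by
      rw [hnear, sub_self, norm_zero]
      exact mul_nonneg hBr (inv_nonneg.2 (by linarith)))
  have hrel := ae_tendsto_average_cutPlaneWave hDb hf hχ hx (x' := -x) (by rwa [norm_neg]) he he' hτ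
    (B := Bc) (a₁ := fourierT ar (τ • x)) (a₂ := 0)
    (fun s hs => by
      rw [smul_neg, neg_add_eq_sub, hnear, sub_self, norm_zero]
      exact mul_nonneg hBc (inv_nonneg.2 (by linarith)))
    (fun s hs => by
      rw [sub_zero, smul_neg, sub_neg_eq_add, add_comm]
      exact hac s _ hs (hfar s hs))
  filter_upwards [hcov, hrel] with ω h1 h2
  constructor
  · refine (h1.2.const_mul (((‖farConst d‖ ^ 2 : ℝ) : ℂ))).congr fun Q => ?_
    rw [avgCov, mul_left_comm, ← intervalIntegral.integral_const_mul]
    congr 1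
    refine intervalIntegral.integral_congr fun s _ => ?_
    have hn : ((‖farConst d‖ ^ 2 : ℝ) : ℂ) = farConst d * conj (farConst d) := by
      rw [Complex.mul_conj, Complex.normSq_eq_norm_sq]
    simp only [farField, hexp, ← he_def, map_mul, map_neg, Complex.conj_ofReal, hn]
    push_cast
    ring
  · refine (h2.1.const_mul (farConst d ^ 2)).congr fun Q => ?_
    rw [avgRel, mul_left_comm, ← intervalIntegral.integral_const_mul]
    congr 1
    refine intervalIntegral.integral_congr fun s _ => ?_
    simp only [farField, hexp, ← he_def]
    push_cast
    ring

end FarField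

/-! ### Uniqueness from Fourier data in polar coordinates. -/

section Uniqueness

variable {d : ℕ}

/-- The Fourier transform of a compactly supported function extends to an entire function along
each line. -/
theorem differentiable_integral_cexp_mul {g : Space d → ℂ} (hg : Continuous g)
    (hc : HasCompactSupport g) (ξ v : Space d) :
    Differentiable ℂ fun z : ℂ => ∫ x, Complex.exp (-(Complex.I *
      (((inner ℝ x ξ : ℝ) : ℂ) + z * ((inner ℝ x v : ℝ) : ℂ)))) * g x := by
  intro z₀
  have hcont : ∀ z : ℂ, Continuous fun x : Space d => Complex.exp (-(Complex.I *
      (((inner ℝ x ξ : ℝ) : ℂ) + z * ((inner ℝ x v : ℝ) : ℂ)))) * g x := by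
    intro z
    refine Continuous.mul ?_ hg
    fun_prop
  have hcont' : Continuous fun x : Space d => Complex.exp (-(Complex.I *
      (((inner ℝ x ξ : ℝ) : ℂ) + z₀ * ((inner ℝ x v : ℝ) : ℂ)))) *
        (-(Complex.I * ((inner ℝ x v : ℝ) : ℂ))) * g x := by
    refine Continuous.mul ?_ hg
    fun_prop
  have hbound : Continuous fun x : Space d =>
      Real.exp ((‖z₀‖ + 1) * |inner ℝ x v|) * |inner ℝ x v| * ‖g x‖ := by
    refine Continuous.mul ?_ hg.norm
    fun_prop
  refine (hasDerivAt_integral_of_dominated_loc_of_deriv_le (μ := volume) (x₀ := z₀)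
    (F := fun (z : ℂ) (x : Space d) => Complex.exp (-(Complex.I *
      (((inner ℝ x ξ : ℝ) : ℂ) + z * ((inner ℝ x v : ℝ) : ℂ)))) * g x)
    (F' := fun (z : ℂ) (x : Space d) => Complex.exp (-(Complex.I *
      (((inner ℝ x ξ : ℝ) : ℂ) + z * ((inner ℝ x v : ℝ) : ℂ)))) *
        (-(Complex.I * ((inner ℝ x v : ℝ) : ℂ))) * g x)
    (bound := fun x => Real.exp ((‖z₀‖ + 1) * |inner ℝ x v|) * |inner ℝ x v| * ‖g x‖)
    (Metric.ball_mem_nhds z₀ one_pos) ?_ ?_ ?_ ?_ ?_ ?_).2.differentiableAt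
  · exact Eventually.of_forall fun z => (hcont z).aestronglyMeasurable
  · exact (hcont z₀).integrable_of_hasCompactSupport hc.mul_left
  · exact hcont'.aestronglyMeasurable
  -- The exponential has modulus `exp(Im z · ⟨x, v⟩)`, bounded uniformly on the unit ball around
  -- `z₀`.
  · refine ae_of_all _ fun x z hz => ?_
    have hz' : ‖z‖ ≤ ‖z₀‖ + 1 := by
      have h1 := norm_le_norm_add_norm_sub z₀ z
      rw [mem_ball_iff_norm, norm_sub_rev] at hz
      linarith
    rw [norm_mul, norm_mul, norm_neg, norm_mul, Complex.norm_I, one_mul, Complex.norm_real,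
      Real.norm_eq_abs, Complex.norm_exp]
    gcongr
    have h2 : (-(Complex.I * (((inner ℝ x ξ : ℝ) : ℂ) + z * ((inner ℝ x v : ℝ) : ℂ)))).re
        = z.im * inner ℝ x v := by simp
    rw [h2]
    refine (le_abs_self _).trans ?_
    rw [abs_mul]
    gcongr
    exact (Complex.abs_im_le_norm z).trans hz'
  · exact hbound.integrable_of_hasCompactSupport hc.norm.mul_left
  · refine ae_of_all _ fun x z _ => ?_
    have h1 : HasDerivAt (fun z : ℂ => -(Complex.I *
        (((inner ℝ x ξ : ℝ) : ℂ) + z * ((inner ℝ x v : ℝ) : ℂ))))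
        (-(Complex.I * ((inner ℝ x v : ℝ) : ℂ))) z := by
      have h2 := ((((hasDerivAt_id z).mul_const ((inner ℝ x v : ℝ) : ℂ)).const_add
        ((inner ℝ x ξ : ℝ) : ℂ)).const_mul Complex.I).neg
      convert! h2 using 1
      simp
    exact h1.cexp.mul_const _

/-- Identity theorem on the complexified line through `ξ₀` and `ξ`: the zeros at small real
parameters accumulate at 0, and the parameter 1 is the point `ξ`. -/
theorem fourierT_eq_zero_of_eventually {g : Space d → ℂ} (hg : Continuous g)
    (hc : HasCompactSupport g) {ξ₀ : Space d} (h : ∀ᶠ ξ in 𝓝 ξ₀, fourierT g ξ = 0) (ξ : Space d) :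
    fourierT g ξ = 0 := by
  set F : ℂ → ℂ := fun z => ∫ x, Complex.exp (-(Complex.I *
      (((inner ℝ x ξ₀ : ℝ) : ℂ) + z * ((inner ℝ x (ξ - ξ₀) : ℝ) : ℂ)))) * g x with hF
  have hFd : Differentiable ℂ F := differentiable_integral_cexp_mul hg hc ξ₀ (ξ - ξ₀)
  have hFt : ∀ t : ℝ, F t = fourierT g (ξ₀ + t • (ξ - ξ₀)) := by
    intro t
    simp only [hF, fourierT, inner_add_right, real_inner_smul_right]
    push_cast
    rfl
  have hF0 : ∃ᶠ z in 𝓝[≠] (0 : ℂ), F z = 0 := by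
    have h1 : Tendsto (fun t : ℝ => ξ₀ + t • (ξ - ξ₀)) (𝓝 0) (𝓝 ξ₀) := by
      have : Continuous fun t : ℝ => ξ₀ + t • (ξ - ξ₀) := by fun_prop
      simpa using this.tendsto 0
    have h2 : ∀ᶠ t : ℝ in 𝓝[≠] 0, F t = 0 := by
      filter_upwards [(h1.eventually h).filter_mono nhdsWithin_le_nhds] with t ht
      rw [hFt, ht]
    have h3 : Tendsto (fun t : ℝ => (t : ℂ)) (𝓝[≠] 0) (𝓝[≠] 0) := by
      refine tendsto_nhdsWithin_iff.2 ⟨?_, ?_⟩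
      · exact (Complex.continuous_ofReal.tendsto' 0 0 (by simp)).mono_left nhdsWithin_le_nhds
      · filter_upwards [self_mem_nhdsWithin] with t ht
        simpa using ht
    exact h3.frequently h2.frequently
  have hz := AnalyticOnNhd.eqOn_zero_of_preconnected_of_frequently_eq_zero
    (hFd.differentiableOn.analyticOnNhd isOpen_univ) isPreconnected_univ (mem_univ 0) hF0
    (mem_univ (1 : ℂ))
  have h1 := hFt 1
  rw [Complex.ofReal_one, one_smul, add_sub_cancel] at h1
  rw [← h1]
  exact hz

theorem eq_zero_of_fourierT_eventually_eq_zero {g : Space d → ℂ}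
    (hg : ContDiff ℝ ((⊤ : ℕ∞) : WithTop ℕ∞) g) (hc : HasCompactSupport g) {ξ₀ : Space d}
    (h : ∀ᶠ ξ in 𝓝 ξ₀, fourierT g ξ = 0) (x : Space d) : g x = 0 := by
  have h1 := integral_cexp_mul_fourierT hg hc x
  simp only [fourierT_eq_zero_of_eventually hg.continuous hc h, mul_zero, integral_zero] at h1
  have h2 : (((2 * Real.pi) ^ d : ℝ) : ℂ) ≠ 0 := by
    have : (0 : ℝ) < (2 * Real.pi) ^ d := by positivity
    exact_mod_cast this.ne'
  exact (mul_eq_zero.1 h1.symm).resolve_left h2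

theorem continuous_fourierT {D : Set (Space d)} {g : Space d → ℂ} (hg : IsSmoothCompactIn D g) :
    Continuous (fourierT g) := by
  obtain ⟨S, hS⟩ := exists_schwartzMap_eq_fourierT hg.1 hg.2.1
  rw [← funext hS]
  exact S.continuous

/-- A smooth compactly supported function is determined by its Fourier transform on an open set of
polar coordinates. -/
theorem eq_of_fourierT_eqOn_polar {D D' : Set (Space d)} {a a' : Space d → ℂ}
    (ha : IsSmoothCompactIn D a) (ha' : IsSmoothCompactIn D' a')
    {Θ : Set (ℝ≥0 × Metric.sphere (0 : Space d) 1)} (hΘ : IsOpen Θ) (hne : Θ.Nonempty)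
    (h : ∀ p ∈ Θ, fourierT a' ((p.1 : ℝ) • (p.2 : Space d))
      = fourierT a ((p.1 : ℝ) • (p.2 : Space d))) : a' = a := by
  obtain ⟨⟨τ₀, x₀⟩, h₀⟩ := hne
  -- Polar coordinates degenerate at the origin, so the radius is first increased slightly within
  -- `Θ`.
  obtain ⟨τ, hτ, hτΘ⟩ : ∃ τ : ℝ≥0, 0 < τ ∧ (τ, x₀) ∈ Θ := by
    have h1 : ∀ᶠ τ in 𝓝[>] τ₀, (τ, x₀) ∈ Θ :=
      ((continuous_id.prodMk continuous_const).continuousAt.eventually_mem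
        (hΘ.mem_nhds h₀)).filter_mono nhdsWithin_le_nhds
    obtain ⟨τ, h2, h3⟩ := (h1.and self_mem_nhdsWithin).exists
    exact ⟨τ, lt_of_le_of_lt (zero_le) h3, h2⟩
  have hx₀ : ‖(x₀ : Space d)‖ = 1 := by simp
  set ξ₀ : Space d := (τ : ℝ) • (x₀ : Space d) with hξ₀
  have hτ' : (0 : ℝ) < τ := hτ
  have hξ₀n : ‖ξ₀‖ = τ := by rw [hξ₀, norm_smul, hx₀, mul_one, Real.norm_of_nonneg hτ'.le]
  have hξ₀0 : ξ₀ ≠ 0 := by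
    rw [← norm_pos_iff, hξ₀n]; exact hτ'
  classical
  let dir : Space d → Metric.sphere (0 : Space d) 1 := fun ξ =>
    if h : ξ = 0 then x₀ else ⟨‖ξ‖⁻¹ • ξ, by
      rw [mem_sphere_zero_iff_norm, norm_smul, norm_inv, norm_norm,
        inv_mul_cancel₀ (norm_ne_zero_iff.2 h)]⟩
  have hdir : ∀ ξ, ξ ≠ 0 → (dir ξ : Space d) = ‖ξ‖⁻¹ • ξ := fun ξ hξ => by simp [dir, hξ]
  have hne0 : ∀ᶠ ξ in 𝓝 ξ₀, ξ ≠ 0 := isOpen_ne.eventually_mem hξ₀0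
  have hdirc : ContinuousAt dir ξ₀ := by
    rw [Topology.IsInducing.subtypeVal.continuousAt_iff]
    have h1 : ContinuousAt (fun ξ : Space d => ‖ξ‖⁻¹ • ξ) ξ₀ :=
      (continuous_norm.continuousAt.inv₀ (norm_ne_zero_iff.2 hξ₀0)).smul continuousAt_id
    refine h1.congr ?_
    filter_upwards [hne0] with ξ hξ
    exact (hdir ξ hξ).symm
  have hdir₀ : dir ξ₀ = x₀ := by
    apply Subtype.ext
    rw [hdir _ hξ₀0, hξ₀n, hξ₀, smul_smul, inv_mul_cancel₀ hτ'.ne', one_smul]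
  have hΦ : ContinuousAt (fun ξ : Space d => (‖ξ‖₊, dir ξ)) ξ₀ :=
    continuous_nnnorm.continuousAt.prodMk hdirc
  have hev : ∀ᶠ ξ in 𝓝 ξ₀, (‖ξ‖₊, dir ξ) ∈ Θ := by
    refine hΦ.eventually_mem (hΘ.mem_nhds ?_)
    have : ‖ξ₀‖₊ = τ := NNReal.eq hξ₀n
    rw [hdir₀, this]
    exact hτΘ
  have hzero : ∀ᶠ ξ in 𝓝 ξ₀, fourierT (a' - a) ξ = 0 := by
    filter_upwards [hev, hne0] with ξ hξ hξ0
    have h1 := h _ hξ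
    simp only [coe_nnnorm, hdir ξ hξ0] at h1
    rw [smul_smul, mul_inv_cancel₀ (norm_ne_zero_iff.2 hξ0), one_smul] at h1
    have h2 := integral_sub
      (integrable_cexp_mul (integrable_of_isSmoothCompactIn ha') ξ)
      (integrable_cexp_mul (integrable_of_isSmoothCompactIn ha) ξ)
    simp only [← mul_sub] at h2
    simp only [fourierT] at h1 ⊢
    simp only [Pi.sub_apply]
    rw [h2, h1, sub_self]
  funext x
  exact sub_eq_zero.1 (eq_zero_of_fourierT_eventually_eq_zero (ha'.1.sub ha.1)
    (ha'.2.1.sub ha.2.1) hzero x)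

/-- Countably many null sets are discarded at once; uniqueness of limits gives equality of
transforms on `S`, and continuity extends it to `Θ ⊆ closure S`. -/
theorem determinedOn_of_ae_tendsto {Ω : Type*} [MeasurableSpace Ω] {P : Measure Ω} {c : ℂ}
    (hc : c ≠ 0) {A : Ω → ℝ → Space d → ℝ → ℂ} {D : Set (Space d)} {a : Space d → ℂ}
    (ha : IsSmoothCompactIn D a)
    (hA : ∀ x : Space d, ‖x‖ = 1 → ∀ τ : ℝ, 0 ≤ τ →
      ∀ᵐ ω ∂P, Tendsto (A ω τ x) atTop (𝓝 (c * fourierT a (τ • x))))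
    {Θ : Set (ℝ≥0 × Metric.sphere (0 : Space d) 1)} (hΘ : IsOpen Θ) (hne : Θ.Nonempty) :
    DeterminedOn P c Θ A a := by
  have hS : ∀ S : Set (ℝ≥0 × Metric.sphere (0 : Space d) 1), S.Countable → Θ ⊆ closure S →
      ∀ᵐ ω ∂P, ∀ a' : Space d → ℂ, IsSmoothCompactIn univ a' → (Fits c S (A ω) a' ↔ a' = a) := by
    intro S hSc hSd
    have hfit : ∀ᵐ ω ∂P, Fits c S (A ω) a :=
      (ae_ball_iff hSc).2 fun p _ => hA p.2 (by simp) p.1 p.1.2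
    filter_upwards [hfit] with ω hω a' ha'
    refine ⟨fun hω' => ?_, fun h => h ▸ hω⟩
    refine eq_of_fourierT_eqOn_polar ha ha' hΘ hne fun p hp => ?_
    have hcont : Continuous fun p : ℝ≥0 × Metric.sphere (0 : Space d) 1 =>
        (p.1 : ℝ) • (p.2 : Space d) := by fun_prop
    have hcl : IsClosed {p : ℝ≥0 × Metric.sphere (0 : Space d) 1 |
        fourierT a' ((p.1 : ℝ) • (p.2 : Space d)) = fourierT a ((p.1 : ℝ) • (p.2 : Space d))} :=
      isClosed_eq ((continuous_fourierT ha').comp hcont) ((continuous_fourierT ha).comp hcont)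
    refine closure_minimal (fun q hq => ?_) hcl (hSd hp)
    exact mul_left_cancel₀ hc (tendsto_nhds_unique (hω' q hq) (hω q hq))
  refine ⟨?_, fun S hSc _ hSd => hS S hSc hSd⟩
  -- Fitting on all of `Θ` implies fitting on one countable dense subset, chosen independently of
  -- `ω`.
  obtain ⟨t, htc, htd⟩ := TopologicalSpace.exists_countable_dense Θ
  have hcl : Θ ⊆ closure (Subtype.val '' t) := fun p hp =>
    image_closure_subset_closure_image continuous_subtype_val ⟨⟨p, hp⟩, htd _, rfl⟩
  filter_upwards [hS _ (htc.image _) hcl] with ω hω a' ha' hfit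
  refine (hω a' ha').1 fun p hp => hfit p ?_
  obtain ⟨q, -, rfl⟩ := hp
  exact q.2

theorem farConst_ne_zero (d : ℕ) : farConst d ≠ 0 := by
  have hπ : (Real.pi : ℂ) ≠ 0 := by exact_mod_cast Real.pi_ne_zero
  unfold farConst
  split_ifs
  · refine div_ne_zero (Complex.exp_ne_zero _) ?_
    have : (0 : ℝ) < √(8 * Real.pi) := Real.sqrt_pos.2 (by positivity)
    exact_mod_cast this.ne'
  · simp [hπ]

end Uniqueness

end
end AcousticSource

open AcousticSource
theorem theorem3 {d : ℕ} (hd : d = 2 ∨ d = 3)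
    {Ω : Type*} [MeasurableSpace Ω] (P : Measure Ω) [IsProbabilityMeasure P]
    (m : ℝ) (hm : (d : ℝ) - 4 < m ∧ m ≤ (d : ℝ))
    (D : Set (Space d)) (hDo : IsOpen D) (hDb : Bornology.IsBounded D)
    (f : Ω → Distrib d) (ac ar : Space d → ℂ) (hf : IsCenteredGMIG P f D m ac ar)
    (χ : TestFun d) (hχ : ∀ᶠ y in 𝓝ˢ (closure D), χ y = 1) :
    (∀ x : Space d, ‖x‖ = 1 → ∀ τ : ℝ, 0 ≤ τ → ∀ᵐ ω ∂P,
      Tendsto (fun Q : ℝ => avgCov m (farField χ (f ω)) τ x Q) atTop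
        (𝓝 (((‖farConst d‖ ^ 2 : ℝ) : ℂ) * fourierT ac (τ • x))) ∧
      Tendsto (fun Q : ℝ => avgRel m (farField χ (f ω)) τ x Q) atTop
        (𝓝 (farConst d ^ 2 * fourierT ar (τ • x)))) ∧
    ∀ Θ : Set (ℝ≥0 × Metric.sphere (0 : Space d) 1), IsOpen Θ → Θ.Nonempty →
      DeterminedOn P ((‖farConst d‖ ^ 2 : ℝ) : ℂ) Θ
        (fun ω => avgCov m (farField χ (f ω))) ac ∧
      DeterminedOn P (farConst d ^ 2) Θ
        (fun ω => avgRel m (farField χ (f ω))) ar := by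
  have hχD : ∀ y ∈ D, χ y = 1 := fun y hy => hχ.self_of_nhdsSet y (subset_closure hy)
  have hlim : ∀ x : Space d, ‖x‖ = 1 → ∀ τ : ℝ, 0 ≤ τ → ∀ᵐ ω ∂P,
      Tendsto (fun Q : ℝ => avgCov m (farField χ (f ω)) τ x Q) atTop
        (𝓝 (((‖farConst d‖ ^ 2 : ℝ) : ℂ) * fourierT ac (τ • x))) ∧
      Tendsto (fun Q : ℝ => avgRel m (farField χ (f ω)) τ x Q) atTop
        (𝓝 (farConst d ^ 2 * fourierT ar (τ • x))) := fun x hx τ hτ =>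
    ae_tendsto_avgCov_avgRel hd hDb hf hχD hx hτ
  obtain ⟨σc, hσc, -⟩ := hf.cov
  obtain ⟨σr, hσr, -⟩ := hf.rel
  have hC := farConst_ne_zero d
  have hC' : ((‖farConst d‖ ^ 2 : ℝ) : ℂ) ≠ 0 := by
    have : (0 : ℝ) < ‖farConst d‖ ^ 2 := by positivity
    exact_mod_cast this.ne'
  refine ⟨hlim, fun Θ hΘ hne => ⟨?_, ?_⟩⟩
  · exact determinedOn_of_ae_tendsto hC' hσc.2.2.1
      (fun x hx τ hτ => (hlim x hx τ hτ).mono fun ω h => h.1) hΘ hne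
  · exact determinedOn_of_ae_tendsto (pow_ne_zero 2 hC) hσr.2.2.1
      (fun x hx τ hτ => (hlim x hx τ hτ).mono fun ω h => h.2) hΘ hne
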